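/- **Proposition (Separating Horizontal Curves).** Let $D$ be a smooth rank 2 distribution on a smooth $n$-dimensional manifold $M$. Its *Cartan prolongation* is the rank 2 distribution $\mathrm{pr}\,D$ on the fiberwise projectivization $\pi:\mathbb{P}D\to M$ (whose points are the pairs $(q,\ell)$ with $q\in M$ and $\ell\subseteq D(q)$ a line) given by $(\mathrm{pr}\,D)(q,\ell)=\{v\in T_{(q,\ell)}\mathbb{P}D:\pi_*v\in\ell\}$. Put $M_0=M$, $\mathrm{pr}^0D=D$ and, recursively, $M_{k+1}=\mathbb{P}(\mathrm{pr}^kD)$, $\mathrm{pr}^{k+1}D=\mathrm{pr}(\mathrm{pr}^kD)$. For a smooth path $\gamma:(-\varepsilon,\varepsilon)\to M$, horizontal for $D$ (that is, $\gamma'(t)\in D(\gamma(t))$ for all $t$) and with nonvanishing derivative, its prolongation is the curve $\mathrm{pr}\,\gamma(t)=(\gamma(t),[\gamma'(t)])$ in $\mathbb{P}D$, which is again smooth, horizontal for $\mathrm{pr}\,D$ and with nonvanishing derivative; put $\mathrm{pr}^0\gamma=\gamma$ and $\mathrm{pr}^{k+1}\gamma=\mathrm{pr}(\mathrm{pr}^k\gamma)$,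 a curve in $M_{k+1}$. For $k\ge 0$ let $U^k(M)$ be the set of $k$-jets $j^k_0(\gamma)$ at $0$ of smooth curves in $M$ defined near $0\in\mathbb{R}$ with $\gamma'(0)\ne0$, and let $G^k$ be the group of $k$-jets at $0$ of smooth maps $\varphi$ from a neighbourhood of $0\in\mathbb{R}$ to $\mathbb{R}$ with $\varphi(0)=0$ and $\varphi'(0)\neq0$, acting on $U^k(M)$ from the right by $j^k_0(\gamma)\cdot j^k_0(\varphi)=j^k_0(\gamma\circ\varphi)$. The class $[j^k_0(\gamma)]\in U^k(M)/G^k$ is the unparameterized $k$-jet of $\gamma$ at $0$. Let $\varepsilon>0$ and let $\gamma_1,\gamma_2:(-\varepsilon,\varepsilon)\to M$ be smooth paths, horizontal with respect to $D$ and with nonvanishing derivatives. Then for every $k\ge0$ $$[j^k_0(\gamma_1)]=[j^k_0(\gamma_2)]\in U^k(M)/G^k\quad\Longleftrightarrow\quad \mathrm{pr}^k\gamma_1(0)=\mathrm{pr}^k\gamma_2(0)\in M_k.$$ -/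

import Mathlib

open scoped Manifold ContDiff Topology
open Set

namespace CartanProlongation

universe u v w

section Jets

theorem iteratedFDeriv_eq_iff {E : Type*} [NormedAddCommGroup E] [NormedSpace ℝ E] {f g : ℝ → E}
    {i : ℕ} {x : ℝ} :
    iteratedFDeriv ℝ i f x = iteratedFDeriv ℝ i g x ↔ iteratedDeriv i f x = iteratedDeriv i g x := by
  constructor
  · intro h; rw [iteratedDeriv_eq_iteratedFDeriv, h, iteratedDeriv_eq_iteratedFDeriv]
  · intro h
    refine ContinuousMultilinearMap.ext fun m => ?_
    rw [iteratedFDeriv_apply_eq_iteratedDeriv_mul_prod, h,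
      iteratedFDeriv_apply_eq_iteratedDeriv_mul_prod]

theorem iteratedDeriv_comp_congr {E : Type*} [NormedAddCommGroup E] [NormedSpace ℝ E]
    {f f' : ℝ → E} {φ φ' : ℝ → ℝ} {k : ℕ} (h0 : φ 0 = 0) (h0' : φ' 0 = 0)
    (hf : ContDiffAt ℝ ∞ f 0) (hf' : ContDiffAt ℝ ∞ f' 0)
    (hφ : ContDiffAt ℝ ∞ φ 0) (hφ' : ContDiffAt ℝ ∞ φ' 0)
    (hff' : ∀ i ≤ k, iteratedDeriv i f 0 = iteratedDeriv i f' 0)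
    (hφφ' : ∀ i ≤ k, iteratedDeriv i φ 0 = iteratedDeriv i φ' 0) :
    ∀ i ≤ k, iteratedDeriv i (f ∘ φ) 0 = iteratedDeriv i (f' ∘ φ') 0 := by
  intro i hi
  have hn : (i : WithTop ℕ∞) ≤ ∞ := by exact_mod_cast le_top
  rw [← iteratedFDeriv_eq_iff, iteratedFDeriv_comp (n := ∞) (by rwa [h0]) hφ hn,
    iteratedFDeriv_comp (n := ∞) (by rwa [h0']) hφ' hn, h0, h0']
  unfold FormalMultilinearSeries.taylorComp FormalMultilinearSeries.compAlongOrderedFinpartition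
  refine Finset.sum_congr rfl fun c _ => ?_
  have h1 : ftaylorSeries ℝ f 0 c.length = ftaylorSeries ℝ f' 0 c.length :=
    iteratedFDeriv_eq_iff.2 (hff' _ (c.length_le.trans hi))
  have h2 : ∀ m, ftaylorSeries ℝ φ 0 (c.partSize m) = ftaylorSeries ℝ φ' 0 (c.partSize m) :=
    fun m => iteratedFDeriv_eq_iff.2 (hφφ' _ ((c.partSize_le m).trans hi))
  rw [h1]
  congr 1
  funext m
  exact h2 m

/-- Local smooth reparameterizations of `ℝ` at the origin, fixing the origin. -/
structure Reparam where
  toFun : ℝ → ℝ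
  smooth : ∀ᶠ t in 𝓝 (0 : ℝ), ContDiffAt ℝ ∞ toFun t
  map_zero : toFun 0 = 0
  deriv_ne_zero : deriv toFun 0 ≠ 0

namespace Reparam

theorem contDiffAt (φ : Reparam) : ContDiffAt ℝ ∞ φ.toFun 0 := φ.smooth.self_of_nhds

theorem tendsto (φ : Reparam) : Filter.Tendsto φ.toFun (𝓝 0) (𝓝 0) := by
  simpa [φ.map_zero] using φ.contDiffAt.continuousAt.tendsto

/-- Two reparameterizations have the same `k`-jet at `0`. -/
def setoid (k : ℕ) : Setoid Reparam where
  r φ ψ := ∀ i ≤ k, iteratedDeriv i φ.toFun 0 = iteratedDeriv i ψ.toFun 0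
  iseqv := ⟨fun _ _ _ => rfl, fun h i hi => (h i hi).symm, fun h h' i hi => (h i hi).trans (h' i hi)⟩

def id : Reparam where
  toFun t := t
  smooth := Filter.Eventually.of_forall fun _ => contDiffAt_id
  map_zero := rfl
  deriv_ne_zero := by simp

def comp (φ ψ : Reparam) : Reparam where
  toFun := φ.toFun ∘ ψ.toFun
  smooth := by
    filter_upwards [ψ.tendsto.eventually φ.smooth, ψ.smooth] with t h1 h2 using h1.comp t h2
  map_zero := by simp [φ.map_zero, ψ.map_zero]
  deriv_ne_zero := by
    have h1 : DifferentiableAt ℝ φ.toFun (ψ.toFun 0) := by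
      rw [ψ.map_zero]; exact φ.contDiffAt.differentiableAt (by simp)
    rw [deriv_comp 0 h1 (ψ.contDiffAt.differentiableAt (by simp)), ψ.map_zero]
    exact mul_ne_zero φ.deriv_ne_zero ψ.deriv_ne_zero

theorem comp_congr {k : ℕ} {φ φ' ψ ψ' : Reparam} (h : setoid k φ φ') (h' : setoid k ψ ψ') :
    setoid k (φ.comp ψ) (φ'.comp ψ') :=
  iteratedDeriv_comp_congr (f := φ.toFun) (f' := φ'.toFun) ψ.map_zero ψ'.map_zero φ.contDiffAt φ'.contDiffAt ψ.contDiffAt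
    ψ'.contDiffAt h h'

theorem exists_inverse (φ : Reparam) : ∃ ψ : Reparam, φ.toFun ∘ ψ.toFun =ᶠ[𝓝 0] fun t => t := by
  have hd : HasDerivAt φ.toFun (deriv φ.toFun 0) 0 :=
    (φ.contDiffAt.differentiableAt (by simp)).hasDerivAt
  have hs : HasStrictDerivAt φ.toFun (deriv φ.toFun 0) 0 :=
    φ.contDiffAt.hasStrictDerivAt' hd (by simp)
  have hf := hs.hasStrictFDerivAt_equiv φ.deriv_ne_zero
  set e := hf.toOpenPartialHomeomorph φ.toFun with he
  have hcoe : (e : ℝ → ℝ) = φ.toFun := rfl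
  have hsrc : (0 : ℝ) ∈ e.source := hf.mem_toOpenPartialHomeomorph_source
  have htgt : (0 : ℝ) ∈ e.target := by
    have := e.map_source hsrc
    rwa [hcoe, φ.map_zero] at this
  have hz : e.symm 0 = 0 := by
    have := e.left_inv hsrc
    rwa [hcoe, φ.map_zero] at this
  have ht : Filter.Tendsto e.symm (𝓝 0) (𝓝 0) := by
    simpa [hz] using (e.continuousAt_symm htgt).tendsto
  have hdne : ∀ᶠ t in 𝓝 (0 : ℝ), deriv φ.toFun t ≠ 0 := by
    have hc : ContinuousAt (deriv φ.toFun) 0 :=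
      (φ.contDiffAt.fderiv_right (m := 0) (by simp)).continuousAt.clm_apply continuousAt_const
    exact hc.eventually_ne φ.deriv_ne_zero
  have hsm : ∀ᶠ t in 𝓝 (0 : ℝ), ContDiffAt ℝ ∞ e.symm t := by
    filter_upwards [ht.eventually hdne, ht.eventually φ.smooth, e.open_target.mem_nhds htgt]
      with t h1 h2 h3
    exact e.contDiffAt_symm_deriv h1 h3 (h2.differentiableAt (by simp)).hasDerivAt h2
  have hinv : φ.toFun ∘ e.symm =ᶠ[𝓝 0] fun t => t := by
    filter_upwards [e.open_target.mem_nhds htgt] with t h using e.right_inv h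
  refine ⟨⟨e.symm, hsm, hz, ?_⟩, hinv⟩
  intro h0
  have h1 := hinv.deriv_eq
  have h2 : DifferentiableAt ℝ φ.toFun (e.symm 0) := by
    rw [hz]; exact φ.contDiffAt.differentiableAt (by simp)
  rw [deriv_comp 0 h2 (hsm.self_of_nhds.differentiableAt (by simp)), h0] at h1
  simp at h1

end Reparam

/-- The group `G^k` of `k`-jets at `0` of local smooth reparameterizations fixing the origin. -/
def JetGroup (k : ℕ) : Type := Quotient (Reparam.setoid k)

namespace JetGroup

variable {k : ℕ}

/-- The `k`-jet of a reparameterization. -/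
def mk (φ : Reparam) : JetGroup k := Quotient.mk (Reparam.setoid k) φ

/-- The group law `j^k φ * j^k ψ = j^k (φ ∘ ψ)`. -/
instance : Mul (JetGroup k) :=
  ⟨Quotient.map₂ Reparam.comp fun _ _ h _ _ h' => Reparam.comp_congr h h'⟩

instance : One (JetGroup k) := ⟨mk Reparam.id⟩

noncomputable instance : Inv (JetGroup k) := ⟨fun g => mk g.out.exists_inverse.choose⟩

noncomputable instance : Group (JetGroup k) :=
  Group.ofRightAxioms
    (by rintro ⟨φ⟩ ⟨ψ⟩ ⟨χ⟩; rfl)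
    (by rintro ⟨φ⟩; rfl)
    (by
      intro g
      have h : (mk (g.out.comp g.out.exists_inverse.choose) : JetGroup k) = mk Reparam.id :=
        Quotient.sound fun i _ => g.out.exists_inverse.choose_spec.iteratedDeriv_eq i
      have h' : (mk g.out : JetGroup k) = g := g.out_eq
      calc g * g⁻¹ = (mk g.out : JetGroup k) * g⁻¹ := by rw [h']
        _ = 1 := h)

end JetGroup

variable {E : Type v} [NormedAddCommGroup E] [NormedSpace ℝ E]
  {M : Type u} [TopologicalSpace M] [ChartedSpace E M]

/-- The velocity `γ'(t) ∈ T_(γ t) M` of a curve in `M`. -/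
noncomputable def velocity (γ : ℝ → M) (t : ℝ) : TangentSpace 𝓘(ℝ, E) (γ t) :=
  mfderiv 𝓘(ℝ) 𝓘(ℝ, E) γ t (1 : ℝ)

variable (E M) in
/-- Curves in `M` which are smooth near `0` and have nonzero velocity at `0`. -/
structure RegularCurve where
  toFun : ℝ → M
  smooth : ∀ᶠ t in 𝓝 (0 : ℝ), ContMDiffAt 𝓘(ℝ) 𝓘(ℝ, E) ∞ toFun t
  velocity_ne_zero : velocity (E := E) toFun 0 ≠ 0

namespace RegularCurve

variable (E M) in
/-- Two curves have the same `k`-jet at `0`: they have the same value at `0` and, in the preferred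
chart at this point, the same derivatives at `0` up to order `k`. -/
def setoid (k : ℕ) : Setoid (RegularCurve E M) where
  r γ δ := γ.toFun 0 = δ.toFun 0 ∧ ∀ i ≤ k,
    iteratedDeriv i (chartAt E (γ.toFun 0) ∘ γ.toFun) 0 =
      iteratedDeriv i (chartAt E (γ.toFun 0) ∘ δ.toFun) 0
  iseqv := by
    refine ⟨fun _ => ⟨rfl, fun _ _ => rfl⟩, fun h => ⟨h.1.symm, fun i hi => ?_⟩,
      fun h h' => ⟨h.1.trans h'.1, fun i hi => ?_⟩⟩
    · rw [← h.1]; exact (h.2 i hi).symm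
    · rw [h.2 i hi]
      have := h'.2 i hi
      rwa [← h.1] at this

theorem velocity_comp_ne_zero (γ : RegularCurve E M) (φ : Reparam) :
    velocity (E := E) (γ.toFun ∘ φ.toFun) 0 ≠ 0 := by
  have hγ : MDifferentiableAt 𝓘(ℝ) 𝓘(ℝ, E) γ.toFun (φ.toFun 0) := by
    rw [φ.map_zero]; exact γ.smooth.self_of_nhds.mdifferentiableAt (by simp)
  have hφ : MDifferentiableAt 𝓘(ℝ) 𝓘(ℝ) φ.toFun 0 :=
    (φ.contDiffAt.differentiableAt (by simp)).mdifferentiableAt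
  have h := mfderiv_comp 0 hγ hφ
  have hv : (velocity (E := E) (γ.toFun ∘ φ.toFun) 0 : E) =
      deriv φ.toFun 0 • (velocity (E := E) γ.toFun (φ.toFun 0) : E) := by
    unfold velocity
    rw [h, mfderiv_eq_fderiv]
    have h1 : fderiv ℝ φ.toFun 0 (1 : ℝ) = deriv φ.toFun 0 • (1 : ℝ) := by simp
    have h2 := congrArg (fun s : ℝ => (mfderiv 𝓘(ℝ) 𝓘(ℝ, E) γ.toFun (φ.toFun 0) s : E)) h1
    refine Eq.trans h2 ?_
    exact map_smul (mfderiv 𝓘(ℝ) 𝓘(ℝ, E) γ.toFun (φ.toFun 0)) (deriv φ.toFun 0) (1 : ℝ)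
  intro h0
  have h3 : deriv φ.toFun 0 • (velocity (E := E) γ.toFun (φ.toFun 0) : E) = 0 := hv.symm.trans h0
  rw [φ.map_zero] at h3
  exact γ.velocity_ne_zero ((smul_eq_zero.1 h3).resolve_left φ.deriv_ne_zero)

/-- The reparameterized curve `γ ∘ φ`. -/
def comp (γ : RegularCurve E M) (φ : Reparam) : RegularCurve E M where
  toFun := γ.toFun ∘ φ.toFun
  smooth := by
    filter_upwards [φ.tendsto.eventually γ.smooth, φ.smooth] with t h1 h2
    exact h1.comp t h2.contMDiffAt
  velocity_ne_zero := γ.velocity_comp_ne_zero φ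

variable [IsManifold 𝓘(ℝ, E) ∞ M]

theorem contDiffAt_chart_comp (γ : RegularCurve E M) {x : M} (hx : γ.toFun 0 = x) :
    ContDiffAt ℝ ∞ (chartAt E x ∘ γ.toFun) 0 := by
  subst hx
  have h := (contMDiffOn_chart (I := 𝓘(ℝ, E)) (n := ∞) (x := γ.toFun 0)).contMDiffAt
    ((chartAt E (γ.toFun 0)).open_source.mem_nhds (mem_chart_source E _))
  exact (h.comp 0 γ.smooth.self_of_nhds).contDiffAt

theorem comp_congr {k : ℕ} {γ γ' : RegularCurve E M} {φ φ' : Reparam}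
    (h : setoid E M k γ γ') (h' : Reparam.setoid k φ φ') :
    setoid E M k (γ.comp φ) (γ'.comp φ') := by
  have e : (γ.comp φ).toFun 0 = γ.toFun 0 := congrArg γ.toFun φ.map_zero
  have e' : (γ'.comp φ').toFun 0 = γ'.toFun 0 := congrArg γ'.toFun φ'.map_zero
  refine ⟨by rw [e, e', h.1], ?_⟩
  rw [e]
  exact iteratedDeriv_comp_congr φ.map_zero φ'.map_zero (γ.contDiffAt_chart_comp rfl)
    (γ'.contDiffAt_chart_comp h.1.symm) φ.contDiffAt φ'.contDiffAt h.2 h'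

end RegularCurve

variable (E M) in
/-- The space `U^k(M)` of `k`-jets at `0` of curves in `M` with nonzero velocity at `0`. -/
def RegularJet (k : ℕ) : Type u := Quotient (RegularCurve.setoid E M k)

/-- The right action of `G^k` on `U^k(M)`, `j^k γ . j^k φ = j^k (γ ∘ φ)`. A right action of a group is
in Mathlib a left action of the opposite group. -/
noncomputable instance [IsManifold 𝓘(ℝ, E) ∞ M] (k : ℕ) : MulAction (JetGroup k)ᵐᵒᵖ (RegularJet E M k) where
  smul g J := Quotient.map₂ (fun γ φ => RegularCurve.comp γ φ)
    (fun _ _ h _ _ h' => RegularCurve.comp_congr h h') J g.unop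
  one_smul := by rintro ⟨γ⟩; rfl
  mul_smul := by rintro ⟨⟨φ⟩⟩ ⟨⟨ψ⟩⟩ ⟨γ⟩; rfl

/-- The `k`-jet at `0` of a curve with nonzero velocity at `0`. -/
def RegularCurve.jet (k : ℕ) (γ : RegularCurve E M) : RegularJet E M k :=
  Quotient.mk (RegularCurve.setoid E M k) γ

variable (E M) in
/-- The orbit space `U^k(M) / G^k` of unparameterized `k`-jets of curves in `M`. -/
def UnparamJet [IsManifold 𝓘(ℝ, E) ∞ M] (k : ℕ) : Type u :=
  MulAction.orbitRel.Quotient (JetGroup k)ᵐᵒᵖ (RegularJet E M k)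

/-- The unparameterized `k`-jet at `0` of a curve with nonzero velocity at `0`. -/
noncomputable def RegularCurve.unparamJet [IsManifold 𝓘(ℝ, E) ∞ M] (k : ℕ) (γ : RegularCurve E M) :
    UnparamJet E M k :=
  Quotient.mk (MulAction.orbitRel (JetGroup k)ᵐᵒᵖ (RegularJet E M k)) (γ.jet k)

end Jets

section Distribution

variable {E : Type v} [NormedAddCommGroup E] [NormedSpace ℝ E]
  {M : Type u} [TopologicalSpace M] [ChartedSpace E M]

/-- A smooth local frame, on an open set `U`, of a family `D` of linear subspaces of the tangent
spaces of `M`: two smooth vector fields on `U` which form a basis of `D q` for each `q ∈ U`. -/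
structure LocalFrame [IsManifold 𝓘(ℝ, E) ∞ M]
    (D : ∀ q : M, Submodule ℝ (TangentSpace 𝓘(ℝ, E) q)) where
  U : Set M
  isOpen : IsOpen U
  X : ∀ q : M, TangentSpace 𝓘(ℝ, E) q
  Y : ∀ q : M, TangentSpace 𝓘(ℝ, E) q
  smooth_X : ContMDiffOn 𝓘(ℝ, E) 𝓘(ℝ, E).tangent ∞
    (fun q => (⟨q, X q⟩ : TangentBundle 𝓘(ℝ, E) M)) U
  smooth_Y : ContMDiffOn 𝓘(ℝ, E) 𝓘(ℝ, E).tangent ∞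
    (fun q => (⟨q, Y q⟩ : TangentBundle 𝓘(ℝ, E) M)) U
  indep : ∀ q ∈ U, LinearIndependent ℝ ![X q, Y q]
  span_eq : ∀ q ∈ U, D q = Submodule.span ℝ {X q, Y q}

variable (E M) in
/-- A smooth rank 2 distribution on `M`: a family of linear subspaces of the tangent spaces which
has a smooth local frame (consisting of two vector fields) near each point. -/
structure RankTwoDistribution [IsManifold 𝓘(ℝ, E) ∞ M] where
  plane : ∀ q : M, Submodule ℝ (TangentSpace 𝓘(ℝ, E) q)
  exists_frame : ∀ q : M, ∃ F : LocalFrame plane, q ∈ F.U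

variable [IsManifold 𝓘(ℝ, E) ∞ M]

/-- The fiberwise projectivization `ℙD` of `D`: pairs `(q, ℓ)` where `q` is a point of `M` and `ℓ` is a
one-dimensional linear subspace of `D q`. -/
@[ext]
structure ProjD (D : RankTwoDistribution E M) where
  pt : M
  line : Submodule ℝ (TangentSpace 𝓘(ℝ, E) pt)
  line_le : line ≤ D.plane pt
  finrank_line : Module.finrank ℝ line = 1

/-- The exchange of the two vector fields of a frame. -/
def LocalFrame.swap {D : ∀ q : M, Submodule ℝ (TangentSpace 𝓘(ℝ, E) q)} (F : LocalFrame D) :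
    LocalFrame D where
  U := F.U
  isOpen := F.isOpen
  X := F.Y
  Y := F.X
  smooth_X := F.smooth_Y
  smooth_Y := F.smooth_X
  indep q hq := by
    have h := F.indep q hq
    rw [LinearIndependent.pair_iff] at h ⊢
    intro s t hst
    have := h t s (by rw [add_comm]; exact hst)
    exact ⟨this.2, this.1⟩
  span_eq q hq := by rw [F.span_eq q hq, Set.pair_comm]

variable {D : RankTwoDistribution E M}

theorem LocalFrame.coeff_unique {D : ∀ q : M, Submodule ℝ (TangentSpace 𝓘(ℝ, E) q)}
    (F : LocalFrame D) {q : M} (hq : q ∈ F.U) {a b a' b' : ℝ}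
    (h : a • F.X q + b • F.Y q = a' • F.X q + b' • F.Y q) : a = a' ∧ b = b' := by
  have h1 := LinearIndependent.pair_iff.1 (F.indep q hq) (a - a') (b - b') (by
    rw [sub_smul, sub_smul]
    have := sub_eq_zero.2 h
    rw [← this]; abel)
  exact ⟨sub_eq_zero.1 h1.1, sub_eq_zero.1 h1.2⟩

theorem LocalFrame.exists_coeff {D : ∀ q : M, Submodule ℝ (TangentSpace 𝓘(ℝ, E) q)}
    (F : LocalFrame D) {q : M} (hq : q ∈ F.U) {v : TangentSpace 𝓘(ℝ, E) q} (hv : v ∈ D q) :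
    ∃ a b : ℝ, v = a • F.X q + b • F.Y q := by
  rw [F.span_eq q hq, Submodule.mem_span_pair] at hv
  obtain ⟨a, b, h⟩ := hv
  exact ⟨a, b, h.symm⟩

theorem LocalFrame.X_mem {D : ∀ q : M, Submodule ℝ (TangentSpace 𝓘(ℝ, E) q)}
    (F : LocalFrame D) {q : M} (hq : q ∈ F.U) : F.X q ∈ D q := by
  rw [F.span_eq q hq]; exact Submodule.subset_span (by simp)

theorem LocalFrame.Y_mem {D : ∀ q : M, Submodule ℝ (TangentSpace 𝓘(ℝ, E) q)}
    (F : LocalFrame D) {q : M} (hq : q ∈ F.U) : F.Y q ∈ D q := by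
  rw [F.span_eq q hq]; exact Submodule.subset_span (by simp)

/-- The direction `X + a Y` at `q`. -/
noncomputable def LocalFrame.dir {D : ∀ q : M, Submodule ℝ (TangentSpace 𝓘(ℝ, E) q)}
    (F : LocalFrame D) (q : M) (a : ℝ) : TangentSpace 𝓘(ℝ, E) q := F.X q + a • F.Y q

theorem LocalFrame.dir_ne_zero {D : ∀ q : M, Submodule ℝ (TangentSpace 𝓘(ℝ, E) q)}
    (F : LocalFrame D) {q : M} (hq : q ∈ F.U) (a : ℝ) : F.dir q a ≠ 0 := by
  intro h
  have := F.coeff_unique hq (a := 1) (b := a) (a' := 0) (b' := 0) (by simpa [dir] using h)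
  exact one_ne_zero this.1

theorem LocalFrame.dir_mem {D : ∀ q : M, Submodule ℝ (TangentSpace 𝓘(ℝ, E) q)}
    (F : LocalFrame D) {q : M} (hq : q ∈ F.U) (a : ℝ) : F.dir q a ∈ D q :=
  (D q).add_mem (F.X_mem hq) ((D q).smul_mem a (F.Y_mem hq))

theorem LocalFrame.span_dir_eq_iff {D : ∀ q : M, Submodule ℝ (TangentSpace 𝓘(ℝ, E) q)}
    (F : LocalFrame D) {q : M} (hq : q ∈ F.U) (a b c : ℝ)
    (h0 : b • F.X q + c • F.Y q ≠ 0) :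
    Submodule.span ℝ {b • F.X q + c • F.Y q} = Submodule.span ℝ {F.dir q a} ↔
      b ≠ 0 ∧ a = c / b := by
  constructor
  · intro h
    have h1 : F.dir q a ∈ Submodule.span ℝ {b • F.X q + c • F.Y q} := by
      rw [h]; exact Submodule.mem_span_singleton_self _
    obtain ⟨s, hs⟩ := Submodule.mem_span_singleton.1 h1
    have := F.coeff_unique hq (a := s * b) (b := s * c) (a' := 1) (b' := a) (by
      rw [one_smul, mul_smul, mul_smul, ← smul_add, hs, dir])
    have hb : b ≠ 0 := by
      rintro rfl; simp at this
    refine ⟨hb, ?_⟩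
    rw [← this.2, eq_div_iff hb]
    linear_combination c * this.1
  · rintro ⟨hb, rfl⟩
    have : b • F.X q + c • F.Y q = b • F.dir q (c / b) := by
      rw [dir, smul_add, smul_smul, mul_div_cancel₀ _ hb]
    rw [this]
    exact Submodule.span_singleton_smul_eq (IsUnit.mk0 b hb) _

theorem LocalFrame.span_dir_injective {D : ∀ q : M, Submodule ℝ (TangentSpace 𝓘(ℝ, E) q)}
    (F : LocalFrame D) {q : M} (hq : q ∈ F.U) {a b : ℝ}
    (h : Submodule.span ℝ {F.dir q a} = Submodule.span ℝ {F.dir q b}) : a = b := by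
  have := (F.span_dir_eq_iff hq b 1 a (by simpa [dir] using F.dir_ne_zero hq a)).1
    (by simpa [dir] using h)
  simpa using this.2.symm

namespace ProjD

theorem exists_line (D : RankTwoDistribution E M) (q : M) :
    ∃ ℓ : Submodule ℝ (TangentSpace 𝓘(ℝ, E) q), ℓ ≤ D.plane q ∧ Module.finrank ℝ ℓ = 1 := by
  obtain ⟨F, hF⟩ := D.exists_frame q
  refine ⟨Submodule.span ℝ {F.dir q 0}, ?_, finrank_span_singleton (F.dir_ne_zero hF 0)⟩
  rw [Submodule.span_singleton_le_iff_mem]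
  exact F.dir_mem hF 0

open Classical in
/-- The point `(q, span v)` of `ℙD` determined by a nonzero vector `v ∈ D q` (with an arbitrary line of
`D q` as value if `v = 0` or `v ∉ D q`). -/
noncomputable def ofVec (D : RankTwoDistribution E M) (q : M) (v : TangentSpace 𝓘(ℝ, E) q) :
    ProjD D :=
  if h : v ∈ D.plane q ∧ v ≠ 0 then
    ⟨q, Submodule.span ℝ {v}, (Submodule.span_singleton_le_iff_mem v (D.plane q)).2 h.1,
      finrank_span_singleton h.2⟩
  else ⟨q, (exists_line D q).choose, (exists_line D q).choose_spec.1,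
      (exists_line D q).choose_spec.2⟩

@[simp] theorem ofVec_pt (q : M) (v : TangentSpace 𝓘(ℝ, E) q) : (ofVec D q v).pt = q := by
  unfold ofVec; split_ifs <;> rfl

theorem ofVec_eq {q : M} {v : TangentSpace 𝓘(ℝ, E) q} (hv : v ∈ D.plane q) (h0 : v ≠ 0) :
    ofVec D q v = ⟨q, Submodule.span ℝ {v},
      (Submodule.span_singleton_le_iff_mem v (D.plane q)).2 hv, finrank_span_singleton h0⟩ := by
  unfold ofVec; rw [dif_pos ⟨hv, h0⟩]

theorem exists_eq_ofVec (p : ProjD D) : ∃ v ∈ D.plane p.pt, v ≠ 0 ∧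
    p.line = Submodule.span ℝ {v} := by
  obtain ⟨⟨v, hv⟩, h0, h⟩ := finrank_eq_one_iff'.1 p.finrank_line
  have h0' : v ≠ 0 := fun hh => h0 (by ext; exact hh)
  refine ⟨v, p.line_le hv, h0', le_antisymm ?_ ?_⟩
  · intro w hw
    obtain ⟨c, hc⟩ := h ⟨w, hw⟩
    exact Submodule.mem_span_singleton.2 ⟨c, congrArg Subtype.val hc⟩
  · rw [Submodule.span_singleton_le_iff_mem]; exact hv

open Classical in
/-- The slope `a` of a line of the form `ℝ (X + a Y)`. -/
noncomputable def slope (F : LocalFrame D.plane) (p : ProjD D) : ℝ :=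
  if h : ∃ a : ℝ, p.line = Submodule.span ℝ {F.dir p.pt a} then h.choose else 0

theorem slope_eq {F : LocalFrame D.plane} {p : ProjD D} (hp : p.pt ∈ F.U) {a : ℝ}
    (h : p.line = Submodule.span ℝ {F.dir p.pt a}) : slope F p = a := by
  have h' : ∃ a : ℝ, p.line = Submodule.span ℝ {F.dir p.pt a} := ⟨a, h⟩
  unfold slope
  rw [dif_pos h']
  exact F.span_dir_injective hp (h'.choose_spec.symm.trans h)

theorem slope_ofVec {F : LocalFrame D.plane} {q : M} (hq : q ∈ F.U) {b c : ℝ} (hb : b ≠ 0)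
    {v : TangentSpace 𝓘(ℝ, E) q} (hv : v = b • F.X q + c • F.Y q) :
    slope F (ofVec D q v) = c / b := by
  have h0 : v ≠ 0 := by
    intro h
    have := F.coeff_unique hq (a := b) (b := c) (a' := 0) (b' := 0) (by simp [← hv, h])
    exact hb this.1
  have hm : v ∈ D.plane q := by
    rw [F.span_eq q hq, hv]; exact Submodule.mem_span_pair.2 ⟨b, c, rfl⟩
  rw [ofVec_eq hm h0]
  refine slope_eq hq (?_ : Submodule.span ℝ {v} = Submodule.span ℝ {F.dir q (c / b)})
  subst hv
  exact (F.span_dir_eq_iff hq (c / b) b c h0).2 ⟨hb, rfl⟩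

/-- The chart `(q, ℝ (X + a Y)) ↦ (φ q, a)` of `ℙD` attached to the preferred chart `φ` of `M` at `x` and a
local frame `(X, Y)` of `D`. -/
noncomputable def chart (x : M) (F : LocalFrame D.plane) : PartialEquiv (ProjD D) (E × ℝ) where
  toFun p := (chartAt E x p.pt, slope F p)
  invFun z := ofVec D ((chartAt E x).symm z.1) (F.dir ((chartAt E x).symm z.1) z.2)
  source := {p | p.pt ∈ (chartAt E x).source ∧ p.pt ∈ F.U ∧
    ∃ a : ℝ, p.line = Submodule.span ℝ {F.dir p.pt a}}
  target := {z | z.1 ∈ (chartAt E x).target ∧ (chartAt E x).symm z.1 ∈ F.U}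
  map_source' := by
    rintro p ⟨h1, h2, -⟩
    refine ⟨(chartAt E x).map_source h1, ?_⟩
    simpa [(chartAt E x).left_inv h1] using h2
  map_target' := by
    rintro z ⟨h1, h2⟩
    refine ⟨?_, ?_, z.2, ?_⟩
    · simpa using (chartAt E x).map_target h1
    · simpa using h2
    · rw [ofVec_eq (F.dir_mem h2 _) (F.dir_ne_zero h2 _)]
  left_inv' := by
    rintro p ⟨h1, h2, a, ha⟩
    have hs := slope_eq h2 ha
    simp only [hs]
    rw [(chartAt E x).left_inv h1, ofVec_eq (F.dir_mem h2 _) (F.dir_ne_zero h2 _)]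
    obtain ⟨q, ℓ, hℓ, hr⟩ := p
    change ℓ = Submodule.span ℝ {F.dir q a} at ha
    subst ha
    rfl
  right_inv' := by
    rintro z ⟨h1, h2⟩
    simp only [ofVec_pt]
    rw [slope_ofVec h2 one_ne_zero (c := z.2) (by rw [one_smul]; rfl), div_one,
      (chartAt E x).right_inv h1]

theorem exists_adapted_frame (p : ProjD D) : ∃ F : LocalFrame D.plane, p.pt ∈ F.U ∧
    ∃ a : ℝ, p.line = Submodule.span ℝ {F.dir p.pt a} := by
  obtain ⟨F, hF⟩ := D.exists_frame p.pt
  obtain ⟨v, hv, h0, hl⟩ := p.exists_eq_ofVec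
  obtain ⟨b, c, hbc⟩ := F.exists_coeff hF hv
  by_cases hb : b = 0
  · refine ⟨F.swap, hF, 0, ?_⟩
    have h1 : v = c • F.swap.X p.pt + (0 : ℝ) • F.swap.Y p.pt := by
      rw [hbc, hb]; simp [LocalFrame.swap]
    have hc : c ≠ 0 := by
      rintro rfl
      exact h0 (by rw [hbc, hb]; simp)
    rw [hl, h1]
    exact (F.swap.span_dir_eq_iff hF 0 c 0 (h1 ▸ h0)).2 ⟨hc, by simp⟩
  · refine ⟨F, hF, c / b, ?_⟩
    rw [hl, hbc]
    exact (F.span_dir_eq_iff hF _ b c (hbc ▸ h0)).2 ⟨hb, rfl⟩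

/-- A frame of `D` near the base point of `p` for which `p` is not the line of the second field. -/
noncomputable def adaptedFrame (p : ProjD D) : LocalFrame D.plane := p.exists_adapted_frame.choose

theorem mem_chart_source (p : ProjD D) : p ∈ (chart p.pt p.adaptedFrame).source :=
  ⟨_root_.mem_chart_source E p.pt, p.exists_adapted_frame.choose_spec⟩

end ProjD

section Smooth

variable {EN : Type w} [NormedAddCommGroup EN] [NormedSpace ℝ EN]
  {N : Type*} [TopologicalSpace N] [ChartedSpace EN N]

theorem exists_dual_pair [FiniteDimensional ℝ E] {x y : E} (h : LinearIndependent ℝ ![x, y]) :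
    ∃ f g : E →L[ℝ] ℝ, f x = 1 ∧ f y = 0 ∧ g x = 0 ∧ g y = 1 := by
  classical
  obtain ⟨L, hL⟩ := (Fintype.linearCombination ℝ ![x, y]).exists_leftInverse_of_injective
    (LinearMap.ker_eq_bot.2 h.fintypeLinearCombination_injective)
  have h1 : L x = Pi.single 0 1 := by
    have := congrArg (fun T => T (Pi.single 0 1)) hL
    simpa [Fintype.linearCombination_apply_single] using this
  have h2 : L y = Pi.single 1 1 := by
    have := congrArg (fun T => T (Pi.single 1 1)) hL
    simpa [Fintype.linearCombination_apply_single] using this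
  refine ⟨LinearMap.toContinuousLinearMap ((LinearMap.proj 0).comp L),
    LinearMap.toContinuousLinearMap ((LinearMap.proj 1).comp L), ?_, ?_, ?_, ?_⟩ <;>
  simp [h1, h2]

/-- The coefficients, in a smooth frame, of a vector field smooth along a smooth map are smooth. -/
theorem LocalFrame.contMDiffAt_coeff [FiniteDimensional ℝ E]
    {D : ∀ q : M, Submodule ℝ (TangentSpace 𝓘(ℝ, E) q)}
    (F : LocalFrame D) {f : N → M} {V : ∀ z : N, TangentSpace 𝓘(ℝ, E) (f z)} {z₀ : N}
    (hV : ContMDiffAt 𝓘(ℝ, EN) 𝓘(ℝ, E).tangent ∞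
      (fun z => (⟨f z, V z⟩ : TangentBundle 𝓘(ℝ, E) M)) z₀)
    (hz : f z₀ ∈ F.U) {a b : N → ℝ}
    (hab : ∀ᶠ z in 𝓝 z₀, V z = a z • F.X (f z) + b z • F.Y (f z)) :
    ContMDiffAt 𝓘(ℝ, EN) 𝓘(ℝ) ∞ a z₀ ∧ ContMDiffAt 𝓘(ℝ, EN) 𝓘(ℝ) ∞ b z₀ := by
  set T := trivializationAt E (TangentSpace 𝓘(ℝ, E)) (f z₀) with hT
  have hf : ContMDiffAt 𝓘(ℝ, EN) 𝓘(ℝ, E) ∞ f z₀ := (Bundle.contMDiffAt_totalSpace.1 hV).1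
  have hV' : ContMDiffAt 𝓘(ℝ, EN) 𝓘(ℝ, E) ∞
      (fun z => (T ⟨f z, V z⟩).2) z₀ := (Bundle.contMDiffAt_totalSpace.1 hV).2
  have hU : F.U ∈ 𝓝 (f z₀) := F.isOpen.mem_nhds hz
  have hX : ContMDiffAt 𝓘(ℝ, EN) 𝓘(ℝ, E) ∞ (fun z => (T ⟨f z, F.X (f z)⟩).2) z₀ :=
    ((Bundle.contMDiffAt_section _).1 (F.smooth_X.contMDiffAt hU)).comp z₀ hf
  have hY : ContMDiffAt 𝓘(ℝ, EN) 𝓘(ℝ, E) ∞ (fun z => (T ⟨f z, F.Y (f z)⟩).2) z₀ :=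
    ((Bundle.contMDiffAt_section _).1 (F.smooth_Y.contMDiffAt hU)).comp z₀ hf
  have hbase : ∀ᶠ z in 𝓝 z₀, f z ∈ T.baseSet :=
    hf.continuousAt.preimage_mem_nhds
      (T.open_baseSet.mem_nhds (FiberBundle.mem_baseSet_trivializationAt' (f z₀)))
  have hind : LinearIndependent ℝ ![(T ⟨f z₀, F.X (f z₀)⟩).2, (T ⟨f z₀, F.Y (f z₀)⟩).2] := by
    have hb := hbase.self_of_nhds
    have h := F.indep _ hz
    rw [LinearIndependent.pair_iff] at h ⊢
    intro s t hst
    apply h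
    have hl := (T.continuousLinearEquivAt ℝ (f z₀) hb).injective
    apply hl
    rw [map_add, map_smul, map_smul, map_zero]
    exact hst
  obtain ⟨φ, ψ, h1, h2, h3, h4⟩ := exists_dual_pair hind
  have cφ : ContMDiff 𝓘(ℝ, E) 𝓘(ℝ) ∞ φ := φ.contMDiff
  have cψ : ContMDiff 𝓘(ℝ, E) 𝓘(ℝ) ∞ ψ := ψ.contMDiff
  have hφX := cφ.contMDiffAt.comp z₀ hX
  have hφY := cφ.contMDiffAt.comp z₀ hY
  have hφV := cφ.contMDiffAt.comp z₀ hV'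
  have hψX := cψ.contMDiffAt.comp z₀ hX
  have hψY := cψ.contMDiffAt.comp z₀ hY
  have hψV := cψ.contMDiffAt.comp z₀ hV'
  simp only [Function.comp_def] at hφX hφY hφV hψX hψY hψV
  have hdet := (hφX.mul hψY).sub (hφY.mul hψX)
  have hdet0 : φ (T ⟨f z₀, F.X (f z₀)⟩).2 * ψ (T ⟨f z₀, F.Y (f z₀)⟩).2 -
      φ (T ⟨f z₀, F.Y (f z₀)⟩).2 * ψ (T ⟨f z₀, F.X (f z₀)⟩).2 ≠ 0 := by
    rw [h1, h2, h3, h4]; norm_num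
  have hne := hdet.continuousAt.eventually_ne hdet0
  have hlin : ∀ᶠ z in 𝓝 z₀, (T ⟨f z, V z⟩).2 =
      a z • (T ⟨f z, F.X (f z)⟩).2 + b z • (T ⟨f z, F.Y (f z)⟩).2 := by
    filter_upwards [hbase, hab] with z hz hz'
    have hl := congrArg (T.continuousLinearEquivAt ℝ (f z) hz) hz'
    rw [map_add, map_smul, map_smul] at hl
    exact hl
  constructor
  · refine (((hφV.mul hψY).sub (hφY.mul hψV)).div₀ hdet hdet0).congr_of_eventuallyEq ?_
    filter_upwards [hne, hlin] with z hz hz'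
    simp only [Pi.div_apply, Pi.mul_apply] at hz ⊢
    rw [eq_div_iff hz, hz']
    simp only [map_add, map_smul, smul_eq_mul]
    ring
  · refine (((hφX.mul hψV).sub (hφV.mul hψX)).div₀ hdet hdet0).congr_of_eventuallyEq ?_
    filter_upwards [hne, hlin] with z hz hz'
    simp only [Pi.div_apply, Pi.mul_apply] at hz ⊢
    rw [eq_div_iff hz, hz']
    simp only [map_add, map_smul, smul_eq_mul]
    ring

theorem contMDiffAt_velocity {γ : ℝ → M} {s : Set ℝ} (hs : IsOpen s)
    (hγ : ContMDiffOn 𝓘(ℝ) 𝓘(ℝ, E) ∞ γ s) {t : ℝ} (ht : t ∈ s) :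
    ContMDiffAt 𝓘(ℝ) 𝓘(ℝ, E).tangent ∞
      (fun t => (⟨γ t, velocity γ t⟩ : TangentBundle 𝓘(ℝ, E) M)) t := by
  have h1 := hγ.contMDiffOn_tangentMapWithin (m := ∞) (by simp) hs.uniqueMDiffOn
  have h2 : ContMDiff 𝓘(ℝ) 𝓘(ℝ).tangent ∞
      (fun t : ℝ => (⟨t, (1 : ℝ)⟩ : TangentBundle 𝓘(ℝ) ℝ)) := by
    intro t
    refine (Bundle.contMDiffAt_section (E := (TangentSpace 𝓘(ℝ) : ℝ → Type))
      (s := fun _ => (1 : ℝ)) t).2 ?_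
    have h3 : (fun x : ℝ => (trivializationAt ℝ (TangentSpace 𝓘(ℝ)) t
        (⟨x, (1 : ℝ)⟩ : TangentBundle 𝓘(ℝ) ℝ)).2) = fun _ => (1 : ℝ) := by
      funext x
      simp
    rw [h3]
    exact contMDiffAt_const
  have h4 := (h1.comp h2.contMDiffOn (s := s) (fun x hx => hx)).contMDiffAt (hs.mem_nhds ht)
  refine h4.congr_of_eventuallyEq ?_
  filter_upwards [hs.mem_nhds ht] with x hx
  simp only [Function.comp, tangentMapWithin, velocity]
  rw [mfderivWithin_of_isOpen hs hx]

end Smooth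

namespace ProjD

open Classical in
/-- The coefficients of a vector of `D q` in a frame. -/
noncomputable def coeff (F : LocalFrame D.plane) (q : M) (v : TangentSpace 𝓘(ℝ, E) q) : ℝ × ℝ :=
  if h : ∃ p : ℝ × ℝ, v = p.1 • F.X q + p.2 • F.Y q then h.choose else 0

theorem coeff_spec (F : LocalFrame D.plane) {q : M} (hq : q ∈ F.U) {v : TangentSpace 𝓘(ℝ, E) q}
    (hv : v ∈ D.plane q) : v = (coeff F q v).1 • F.X q + (coeff F q v).2 • F.Y q := by
  obtain ⟨a, b, h⟩ := F.exists_coeff hq hv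
  have h' : ∃ p : ℝ × ℝ, v = p.1 • F.X q + p.2 • F.Y q := ⟨(a, b), h⟩
  unfold coeff
  rw [dif_pos h']
  exact h'.choose_spec

theorem mem_source_ofVec_iff (x : M) (F : LocalFrame D.plane) {q : M} (hq : q ∈ F.U)
    {v : TangentSpace 𝓘(ℝ, E) q} {b c : ℝ} (h0 : v ≠ 0)
    (hbc : v = b • F.X q + c • F.Y q) :
    ofVec D q v ∈ (chart x F).source ↔ q ∈ (chartAt E x).source ∧ b ≠ 0 := by
  have hm : v ∈ D.plane q := by
    rw [F.span_eq q hq, hbc]; exact Submodule.mem_span_pair.2 ⟨b, c, rfl⟩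
  rw [ofVec_eq hm h0]
  change (q ∈ _ ∧ q ∈ F.U ∧ ∃ a : ℝ, Submodule.span ℝ {v} = _) ↔ _
  subst hbc
  simp only [hq, true_and, F.span_dir_eq_iff hq _ b c h0, exists_and_left, exists_eq, and_true]

theorem transition [FiniteDimensional ℝ E] (x x' : M) (F F' : LocalFrame D.plane) {z₀ : E × ℝ}
    (hz₀ : z₀ ∈ ((chart x F).symm.trans (chart x' F')).source) :
    ((chart x F).symm.trans (chart x' F')).source ∈ 𝓝 z₀ ∧
      ContDiffAt ℝ ∞ ((chart x F).symm.trans (chart x' F')) z₀ := by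
  set q : E × ℝ → M := fun z => (chartAt E x).symm z.1 with hqdef
  set α : E × ℝ → ℝ := fun z => (coeff F' (q z) (F.X (q z))).1 + z.2 * (coeff F' (q z) (F.Y (q z))).1
    with hα
  set β : E × ℝ → ℝ := fun z => (coeff F' (q z) (F.X (q z))).2 + z.2 * (coeff F' (q z) (F.Y (q z))).2
    with hβ
  have hdir : ∀ z, q z ∈ F.U → q z ∈ F'.U →
      F.dir (q z) z.2 = α z • F'.X (q z) + β z • F'.Y (q z) := by
    intro z h h'
    have e1 := coeff_spec F' h' (F.X_mem h)
    have e2 := coeff_spec F' h' (F.Y_mem h)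
    simp only [LocalFrame.dir, hα, hβ]
    generalize coeff F' (q z) (F.X (q z)) = c at e1 ⊢
    generalize coeff F' (q z) (F.Y (q z)) = d at e2 ⊢
    rw [e1, e2]
    module
  have hmem : ∀ z, q z ∈ F'.U → (z ∈ ((chart x F).symm.trans (chart x' F')).source ↔
      (z.1 ∈ (chartAt E x).target ∧ q z ∈ F.U) ∧ q z ∈ (chartAt E x').source ∧ α z ≠ 0) := by
    intro z h'
    rw [PartialEquiv.trans_source]
    refine and_congr_right fun h => ?_
    exact mem_source_ofVec_iff x' F' h' (F.dir_ne_zero h.2 _) (hdir z h.2 h')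
  have h₀' : q z₀ ∈ F'.U := by
    have := hz₀.2.2.1
    simpa [chart] using this
  obtain ⟨⟨h1, h2⟩, h3, h4⟩ := (hmem z₀ h₀').1 hz₀
  have hq : ContMDiffAt 𝓘(ℝ, E × ℝ) 𝓘(ℝ, E) ∞ q z₀ := by
    have := (contMDiffOn_chart_symm (I := 𝓘(ℝ, E)) (n := ∞) (x := x)).contMDiffAt
      ((chartAt E x).open_target.mem_nhds h1)
    exact this.comp z₀ contDiff_fst.contMDiff.contMDiffAt
  have hcoeff : ∀ (V : ∀ q : M, TangentSpace 𝓘(ℝ, E) q), (∀ y ∈ F.U, V y ∈ D.plane y) →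
      ContMDiffAt 𝓘(ℝ, E) 𝓘(ℝ, E).tangent ∞
        (fun y => (⟨y, V y⟩ : TangentBundle 𝓘(ℝ, E) M)) (q z₀) →
      ContMDiffAt 𝓘(ℝ, E × ℝ) 𝓘(ℝ) ∞ (fun z => (coeff F' (q z) (V (q z))).1) z₀ ∧
      ContMDiffAt 𝓘(ℝ, E × ℝ) 𝓘(ℝ) ∞ (fun z => (coeff F' (q z) (V (q z))).2) z₀ := by
    intro V hV hs
    refine F'.contMDiffAt_coeff (f := q) (V := fun z => V (q z)) (hs.comp z₀ hq) h₀' ?_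
    filter_upwards [hq.continuousAt.preimage_mem_nhds (F.isOpen.mem_nhds h2),
      hq.continuousAt.preimage_mem_nhds (F'.isOpen.mem_nhds h₀')] with z hz hz'
    exact coeff_spec F' hz' (hV _ hz)
  obtain ⟨hX1, hX2⟩ := hcoeff F.X (fun y hy => F.X_mem hy)
    (F.smooth_X.contMDiffAt (F.isOpen.mem_nhds h2))
  obtain ⟨hY1, hY2⟩ := hcoeff F.Y (fun y hy => F.Y_mem hy)
    (F.smooth_Y.contMDiffAt (F.isOpen.mem_nhds h2))
  have hαs : ContDiffAt ℝ ∞ α z₀ := hX1.contDiffAt.add (contDiffAt_snd.mul hY1.contDiffAt)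
  have hβs : ContDiffAt ℝ ∞ β z₀ := hX2.contDiffAt.add (contDiffAt_snd.mul hY2.contDiffAt)
  have hS : ((chart x F).symm.trans (chart x' F')).source ∈ 𝓝 z₀ := by
    filter_upwards [continuousAt_fst.preimage_mem_nhds ((chartAt E x).open_target.mem_nhds h1),
      hq.continuousAt.preimage_mem_nhds (F.isOpen.mem_nhds h2),
      hq.continuousAt.preimage_mem_nhds (F'.isOpen.mem_nhds h₀'),
      hq.continuousAt.preimage_mem_nhds ((chartAt E x').open_source.mem_nhds h3),
      hαs.continuousAt.eventually_ne h4] with z k1 k2 k3 k4 k5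
    exact (hmem z k3).2 ⟨⟨k1, k2⟩, k4, k5⟩
  refine ⟨hS, ?_⟩
  have hφ : ContDiffAt ℝ ∞ (fun z => chartAt E x' (q z)) z₀ := by
    have := (contMDiffOn_chart (I := 𝓘(ℝ, E)) (n := ∞) (x := x')).contMDiffAt
      ((chartAt E x').open_source.mem_nhds h3)
    exact (this.comp z₀ hq).contDiffAt
  refine (hφ.prodMk (hβs.div hαs h4)).congr_of_eventuallyEq ?_
  filter_upwards [hS, hq.continuousAt.preimage_mem_nhds (F'.isOpen.mem_nhds h₀')] with z hz hz'
  obtain ⟨⟨-, k2⟩, -, k4⟩ := (hmem z hz').1 hz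
  have e1 : slope F' (ofVec D (q z) (F.dir (q z) z.2)) = β z / α z :=
    slope_ofVec hz' k4 (hdir z k2 hz')
  change (chartAt E x' (ofVec D (q z) (F.dir (q z) z.2)).pt,
    slope F' (ofVec D (q z) (F.dir (q z) z.2))) = _
  rw [e1, ofVec_pt]
  rfl

variable [FiniteDimensional ℝ E]

variable (D) in
/-- The atlas of `ℙD` formed by the charts `(q, ℝ (X + a Y)) ↦ (φ q, a)`. -/
noncomputable def core : ChartedSpaceCore (E × ℝ) (ProjD D) where
  atlas := {e | ∃ (x : M) (F : LocalFrame D.plane), e = chart x F}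
  chartAt p := chart p.pt p.adaptedFrame
  mem_chart_source p := p.mem_chart_source
  chart_mem_atlas p := ⟨_, _, rfl⟩
  open_source := by
    rintro _ _ ⟨x, F, rfl⟩ ⟨x', F', rfl⟩
    exact isOpen_iff_mem_nhds.2 fun z hz => (transition x x' F F' hz).1
  continuousOn_toFun := by
    rintro _ _ ⟨x, F, rfl⟩ ⟨x', F', rfl⟩ z hz
    exact (transition x x' F F' hz).2.continuousAt.continuousWithinAt

noncomputable instance : TopologicalSpace (ProjD D) := (core D).toTopologicalSpace

noncomputable instance : ChartedSpace (E × ℝ) (ProjD D) := (core D).toChartedSpace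

instance : IsManifold 𝓘(ℝ, E × ℝ) ∞ (ProjD D) := by
  apply isManifold_of_contDiffOn
  intro e e' he he'
  simp only [atlas, ChartedSpace.atlas, mem_iUnion, mem_singleton_iff] at he he'
  obtain ⟨_, ⟨x, F, rfl⟩, rfl⟩ := he
  obtain ⟨_, ⟨x', F', rfl⟩, rfl⟩ := he'
  intro z hz
  exact (transition x x' F F' hz.1).2.contDiffWithinAt

theorem coe_chartAt (p : ProjD D) :
    (chartAt (E × ℝ) p : ProjD D → E × ℝ) = chart p.pt p.adaptedFrame := rfl

theorem chartAt_source (p : ProjD D) :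
    (chartAt (E × ℝ) p).source = (chart p.pt p.adaptedFrame).source := rfl

theorem chartAt_target (p : ProjD D) :
    (chartAt (E × ℝ) p).target = (chart p.pt p.adaptedFrame).target := rfl

theorem coe_chartAt_symm (p : ProjD D) :
    ((chartAt (E × ℝ) p).symm : E × ℝ → ProjD D) = (chart p.pt p.adaptedFrame).symm := rfl

theorem contMDiff_pt : ContMDiff 𝓘(ℝ, E × ℝ) 𝓘(ℝ, E) ∞ (ProjD.pt : ProjD D → M) := by
  intro p
  have h1 : ContMDiffAt 𝓘(ℝ, E × ℝ) 𝓘(ℝ, E × ℝ) ∞ (chartAt (E × ℝ) p) p :=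
    (contMDiffOn_chart (I := 𝓘(ℝ, E × ℝ)) (n := ∞) (x := p)).contMDiffAt
      ((chartAt (E × ℝ) p).open_source.mem_nhds (_root_.mem_chart_source _ p))
  have h2 : ContMDiffAt 𝓘(ℝ, E) 𝓘(ℝ, E) ∞ (chartAt E p.pt).symm (chartAt (E × ℝ) p p).1 :=
    (contMDiffOn_chart_symm (I := 𝓘(ℝ, E)) (n := ∞) (x := p.pt)).contMDiffAt
      ((chartAt E p.pt).open_target.mem_nhds ((chartAt E p.pt).map_source p.mem_chart_source.1))
  have h3 := h2.comp p ((contDiff_fst (𝕜 := ℝ) (E := E) (F := ℝ)).contMDiff.contMDiffAt.comp p h1)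
  refine h3.congr_of_eventuallyEq ?_
  filter_upwards [(chartAt (E × ℝ) p).open_source.mem_nhds (_root_.mem_chart_source _ p)] with r hr
  exact ((chartAt E p.pt).left_inv hr.1).symm

theorem mdifferentiableAt_pt (p : ProjD D) :
    MDifferentiableAt 𝓘(ℝ, E × ℝ) 𝓘(ℝ, E) (ProjD.pt : ProjD D → M) p :=
  (contMDiff_pt p).mdifferentiableAt (by simp)

/-- The differential of the projection `ℙD → M` is the first projection in the charts of `ℙD`. -/
theorem trivializationAt_mfderiv_pt (p₀ p : ProjD D) (hp : p ∈ (chartAt (E × ℝ) p₀).source)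
    (w : TangentSpace 𝓘(ℝ, E × ℝ) p) :
    (trivializationAt E (TangentSpace 𝓘(ℝ, E)) p₀.pt).continuousLinearMapAt ℝ p.pt
        (mfderiv 𝓘(ℝ, E × ℝ) 𝓘(ℝ, E) (ProjD.pt : ProjD D → M) p w) =
      ((trivializationAt (E × ℝ) (TangentSpace 𝓘(ℝ, E × ℝ)) p₀).continuousLinearMapAt ℝ p w :
        E × ℝ).1 := by
  rw [TangentBundle.continuousLinearMapAt_trivializationAt hp,
    TangentBundle.continuousLinearMapAt_trivializationAt hp.1]
  have hd1 : MDifferentiableAt 𝓘(ℝ, E) 𝓘(ℝ, E) (extChartAt 𝓘(ℝ, E) p₀.pt) p.pt :=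
    mdifferentiableAt_extChartAt hp.1
  have hd2 : MDifferentiableAt 𝓘(ℝ, E × ℝ) 𝓘(ℝ, E × ℝ) (extChartAt 𝓘(ℝ, E × ℝ) p₀) p :=
    mdifferentiableAt_extChartAt hp
  have hd3 : MDifferentiableAt 𝓘(ℝ, E × ℝ) 𝓘(ℝ, E) (Prod.fst : E × ℝ → E)
      (extChartAt 𝓘(ℝ, E × ℝ) p₀ p) :=
    (ContinuousLinearMap.fst ℝ E ℝ).differentiableAt.mdifferentiableAt
  have hcomp : (extChartAt 𝓘(ℝ, E) p₀.pt) ∘ (ProjD.pt : ProjD D → M) =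
      (Prod.fst : E × ℝ → E) ∘ (extChartAt 𝓘(ℝ, E × ℝ) p₀) := rfl
  have e1 := mfderiv_comp p hd1 (mdifferentiableAt_pt p)
  have e2 := mfderiv_comp p hd3 hd2
  rw [hcomp, e2] at e1
  have e3 := congrArg (fun T => T w) e1
  have e4 : mfderiv 𝓘(ℝ, E × ℝ) 𝓘(ℝ, E) (Prod.fst : E × ℝ → E) (extChartAt 𝓘(ℝ, E × ℝ) p₀ p) =
      ContinuousLinearMap.fst ℝ E ℝ := by
    rw [mfderiv_eq_fderiv]
    exact (ContinuousLinearMap.fst ℝ E ℝ).fderiv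
  rw [e4] at e3
  exact e3.symm

end ProjD

variable [FiniteDimensional ℝ E]

/-- The planes of the Cartan prolongation: `(pr D)(q, ℓ)` is the set of `w ∈ T_(q, ℓ) ℙD` with
`π_* w ∈ ℓ`, where `π : ℙD → M` is the projection. -/
noncomputable def RankTwoDistribution.prolongPlane (D : RankTwoDistribution E M) (p : ProjD D) :
    Submodule ℝ (TangentSpace 𝓘(ℝ, E × ℝ) p) :=
  p.line.comap (mfderiv 𝓘(ℝ, E × ℝ) 𝓘(ℝ, E) (ProjD.pt : ProjD D → M) p).toLinearMap

theorem RankTwoDistribution.mem_prolongPlane (D : RankTwoDistribution E M) (p : ProjD D)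
    (w : TangentSpace 𝓘(ℝ, E × ℝ) p) : w ∈ D.prolongPlane p ↔
      mfderiv 𝓘(ℝ, E × ℝ) 𝓘(ℝ, E) (ProjD.pt : ProjD D → M) p w ∈ p.line := Iff.rfl

open ProjD in
theorem RankTwoDistribution.exists_prolongFrame (D : RankTwoDistribution E M) (p₀ : ProjD D) :
    ∃ F : LocalFrame D.prolongPlane, p₀ ∈ F.U := by
  set F := p₀.adaptedFrame
  set TM := trivializationAt E (TangentSpace 𝓘(ℝ, E)) p₀.pt with hTM
  set TP := trivializationAt (E × ℝ) (TangentSpace 𝓘(ℝ, E × ℝ)) p₀ with hTP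
  set U : Set (ProjD D) := (chartAt (E × ℝ) p₀).source with hU
  have hUo : IsOpen U := (chartAt (E × ℝ) p₀).open_source
  have hUM : ∀ p ∈ U, p.pt ∈ TM.baseSet := fun p hp => hp.1
  have hUP : ∀ p ∈ U, p ∈ TP.baseSet := fun p hp => hp
  let u : ProjD D → E := fun p => TM.continuousLinearMapAt ℝ p.pt (F.dir p.pt (slope F p))
  let W : ∀ p : ProjD D, E × ℝ → TangentSpace 𝓘(ℝ, E × ℝ) p := fun p z => TP.symmL ℝ p z
  have hW : ∀ p ∈ U, ∀ z, TP.continuousLinearMapAt ℝ p (W p z) = z := fun p hp z =>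
    TP.continuousLinearMapAt_symmL (hUP p hp) z
  have hW' : ∀ p ∈ U, ∀ w, W p (TP.continuousLinearMapAt ℝ p w) = w := fun p hp w =>
    TP.symmL_continuousLinearMapAt (hUP p hp) w
  have hline : ∀ p ∈ U, p.line = Submodule.span ℝ {F.dir p.pt (slope F p)} := by
    rintro p ⟨-, h2, a, ha⟩
    rw [slope_eq h2 ha]; exact ha
  have hu0 : ∀ p ∈ U, u p ≠ 0 := by
    intro p hp h
    have := TM.symmL_continuousLinearMapAt (R := ℝ) (hUM p hp) (F.dir p.pt (slope F p))
    change TM.symmL ℝ p.pt (u p) = _ at this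
    rw [h, map_zero] at this
    exact F.dir_ne_zero hp.2.1 _ this.symm
  have hsm : ∀ z : ProjD D → E × ℝ, ContMDiffOn 𝓘(ℝ, E × ℝ) 𝓘(ℝ, E × ℝ) ∞ z U →
      ContMDiffOn 𝓘(ℝ, E × ℝ) 𝓘(ℝ, E × ℝ).tangent ∞
        (fun p => (⟨p, W p (z p)⟩ : TangentBundle 𝓘(ℝ, E × ℝ) (ProjD D))) U := by
    intro z hz
    refine (TP.contMDiffOn_section_iff hUo hUP).2 (hz.congr fun p hp => ?_)
    have := hW p hp (z p)
    rwa [TP.continuousLinearMapAt_apply_of_mem ℝ (hUP p hp)] at this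
  have hslope : ContMDiffOn 𝓘(ℝ, E × ℝ) 𝓘(ℝ) ∞ (slope F) U :=
    (contDiff_snd (𝕜 := ℝ) (E := E) (F := ℝ)).contMDiff.comp_contMDiffOn
      (contMDiffOn_chart (I := 𝓘(ℝ, E × ℝ)) (n := ∞) (x := p₀))
  have hfield : ∀ V : ∀ q : M, TangentSpace 𝓘(ℝ, E) q,
      ContMDiffOn 𝓘(ℝ, E) 𝓘(ℝ, E).tangent ∞
        (fun q => (⟨q, V q⟩ : TangentBundle 𝓘(ℝ, E) M)) F.U →
      ContMDiffOn 𝓘(ℝ, E × ℝ) 𝓘(ℝ, E) ∞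
        (fun p : ProjD D => (TM.continuousLinearMapAt ℝ p.pt (V p.pt) : E)) U := by
    intro V hV p hp
    have h1 := (TM.contMDiffAt_section_iff (hUM p hp)).1
      (hV.contMDiffAt (F.isOpen.mem_nhds hp.2.1))
    refine ((h1.comp p (contMDiff_pt p)).contMDiffWithinAt (s := U)).congr ?_ ?_
    · intro r hr
      exact TM.continuousLinearMapAt_apply_of_mem ℝ (hUM r hr) _
    · exact TM.continuousLinearMapAt_apply_of_mem ℝ (hUM p hp) _
  have hus : ContMDiffOn 𝓘(ℝ, E × ℝ) 𝓘(ℝ, E) ∞ u U := by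
    refine ((hfield F.X F.smooth_X).add (hslope.smul (hfield F.Y F.smooth_Y))).congr ?_
    intro p _
    simp [u, LocalFrame.dir, map_add, map_smul]
  refine ⟨⟨U, hUo, fun p => W p (u p, 0), fun p => W p (0, 1), hsm _ ?_, hsm _ contMDiffOn_const,
    ?_, ?_⟩, _root_.mem_chart_source _ p₀⟩
  · exact hus.prodMk_space contMDiffOn_const
  · intro p hp
    rw [LinearIndependent.pair_iff]
    intro s t hst
    have h := congrArg (TP.continuousLinearMapAt ℝ p) hst
    rw [map_add, map_smul, map_smul, hW p hp, hW p hp, map_zero] at h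
    have h1 : s • u p = 0 := by simpa using congrArg Prod.fst h
    have h2 : t = 0 := by simpa using congrArg Prod.snd h
    exact ⟨(smul_eq_zero.1 h1).resolve_right (hu0 p hp), h2⟩
  · intro p hp
    ext w
    rw [D.mem_prolongPlane, hline p hp, Submodule.mem_span_singleton, Submodule.mem_span_pair]
    have key := trivializationAt_mfderiv_pt p₀ p hp w
    constructor
    · rintro ⟨c, hc⟩
      refine ⟨c, (TP.continuousLinearMapAt ℝ p w : E × ℝ).2, ?_⟩
      rw [← hc, map_smul] at key
      change c • u p = _ at key
      rw [← hW' p hp w, hW p hp, ← map_smul, ← map_smul, ← map_add]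
      congr 1
      ext
      · simp [key, hTP]
      · simp
    · rintro ⟨c, d, rfl⟩
      refine ⟨c, ?_⟩
      have k1 : TP.continuousLinearMapAt ℝ p (c • W p (u p, 0) + d • W p (0, 1)) = (c • u p, d) := by
        rw [map_add, map_smul, map_smul, hW p hp, hW p hp]
        simp
      have k3 : TM.continuousLinearMapAt ℝ p.pt (c • F.dir p.pt (slope F p)) = c • u p := by
        rw [map_smul]
      have k4 := key.trans (congrArg Prod.fst k1)
      have k5 := congrArg (TM.symmL ℝ p.pt) (k3.trans k4.symm)
      rwa [TM.symmL_continuousLinearMapAt (hUM p hp),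
        TM.symmL_continuousLinearMapAt (hUM p hp)] at k5

/-- The Cartan prolongation of a smooth rank 2 distribution `D`, a smooth rank 2 distribution on
`ℙD`. -/
noncomputable def RankTwoDistribution.prolong (D : RankTwoDistribution E M) :
    RankTwoDistribution (E × ℝ) (ProjD D) where
  plane := D.prolongPlane
  exists_frame := D.exists_prolongFrame

/-- A smooth path `(-ε, ε) → M`, horizontal with respect to `D` and with nonvanishing derivative. Only
the values on `(-ε, ε)` of the underlying function on `ℝ` are meaningful. -/
structure HorizontalCurve (D : RankTwoDistribution E M) (ε : ℝ) where
  toFun : ℝ → M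
  smooth : ContMDiffOn 𝓘(ℝ) 𝓘(ℝ, E) ∞ toFun (Ioo (-ε) ε)
  horizontal : ∀ t ∈ Ioo (-ε) ε, velocity (E := E) toFun t ∈ D.plane (toFun t)
  velocity_ne_zero : ∀ t ∈ Ioo (-ε) ε, velocity (E := E) toFun t ≠ 0

namespace HorizontalCurve

variable {ε : ℝ}

theorem contMDiffAt_ofVec (γ : HorizontalCurve D ε) {t : ℝ} (ht : t ∈ Ioo (-ε) ε) :
    ContMDiffAt 𝓘(ℝ) 𝓘(ℝ, E × ℝ) ∞
      (fun t => ProjD.ofVec D (γ.toFun t) (velocity γ.toFun t)) t := by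
  set δ : ℝ → ProjD D := fun t => ProjD.ofVec D (γ.toFun t) (velocity γ.toFun t) with hδ
  set p₀ := δ t with hp₀
  set F := p₀.adaptedFrame
  have hpt : p₀.pt = γ.toFun t := ProjD.ofVec_pt _ _
  have hγt : ContMDiffAt 𝓘(ℝ) 𝓘(ℝ, E) ∞ γ.toFun t := γ.smooth.contMDiffAt (isOpen_Ioo.mem_nhds ht)
  have hsrc := p₀.mem_chart_source
  have hF : γ.toFun t ∈ F.U := hpt ▸ hsrc.2.1
  have hev : ∀ᶠ s in 𝓝 t, s ∈ Ioo (-ε) ε ∧ γ.toFun s ∈ F.U ∧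
      γ.toFun s ∈ (chartAt E p₀.pt).source :=
    (isOpen_Ioo.eventually_mem ht).and
      ((hγt.continuousAt.eventually (F.isOpen.eventually_mem hF)).and (hγt.continuousAt.preimage_mem_nhds
        ((chartAt E p₀.pt).open_source.mem_nhds (hpt ▸ hsrc.1))))
  have hspec : ∀ᶠ s in 𝓝 t, velocity γ.toFun s =
      (ProjD.coeff F (γ.toFun s) (velocity γ.toFun s)).1 • F.X (γ.toFun s) +
      (ProjD.coeff F (γ.toFun s) (velocity γ.toFun s)).2 • F.Y (γ.toFun s) := by
    filter_upwards [hev] with s hs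
    exact ProjD.coeff_spec F hs.2.1 (γ.horizontal s hs.1)
  obtain ⟨ha, hb⟩ := F.contMDiffAt_coeff (contMDiffAt_velocity isOpen_Ioo γ.smooth ht) hF hspec
  have hne : (ProjD.coeff F (γ.toFun t) (velocity γ.toFun t)).1 ≠ 0 :=
    ((ProjD.mem_source_ofVec_iff p₀.pt F hF (γ.velocity_ne_zero t ht) hspec.self_of_nhds).1 hsrc).2
  set a : ℝ → ℝ := fun s => (ProjD.coeff F (γ.toFun s) (velocity γ.toFun s)).1 with hadef
  set b : ℝ → ℝ := fun s => (ProjD.coeff F (γ.toFun s) (velocity γ.toFun s)).2 with hbdef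
  have hφ : ContMDiffAt 𝓘(ℝ) 𝓘(ℝ, E) ∞ (fun s => chartAt E p₀.pt (γ.toFun s)) t :=
    ((contMDiffOn_chart (I := 𝓘(ℝ, E)) (n := ∞) (x := p₀.pt)).contMDiffAt
      ((chartAt E p₀.pt).open_source.mem_nhds (hpt ▸ hsrc.1))).comp t hγt
  have hz : ContMDiffAt 𝓘(ℝ) 𝓘(ℝ, E × ℝ) ∞ (fun s => (chartAt E p₀.pt (γ.toFun s), b s / a s)) t :=
    hφ.prodMk_space (hb.div₀ ha hne)
  have hδz : ∀ᶠ s in 𝓝 t, δ s ∈ (chartAt (E × ℝ) p₀).source ∧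
      chartAt (E × ℝ) p₀ (δ s) = (chartAt E p₀.pt (γ.toFun s), b s / a s) := by
    filter_upwards [hev, hspec, ha.continuousAt.eventually_ne hne] with s h1 h2 h3
    refine ⟨(ProjD.mem_source_ofVec_iff p₀.pt F h1.2.1 (γ.velocity_ne_zero s h1.1) h2).2
      ⟨h1.2.2, h3⟩, ?_⟩
    change (chartAt E p₀.pt (δ s).pt, ProjD.slope F (δ s)) = _
    rw [show ProjD.slope F (δ s) = b s / a s from ProjD.slope_ofVec h1.2.1 h3 h2,
      show (δ s).pt = γ.toFun s from ProjD.ofVec_pt _ _]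
  have hz0 : (chartAt E p₀.pt (γ.toFun t), b t / a t) ∈ (chartAt (E × ℝ) p₀).target := by
    rw [← hδz.self_of_nhds.2]
    exact (chartAt (E × ℝ) p₀).map_source hδz.self_of_nhds.1
  have hs := (contMDiffOn_chart_symm (I := 𝓘(ℝ, E × ℝ)) (n := ∞) (x := p₀)).contMDiffAt
    ((chartAt (E × ℝ) p₀).open_target.mem_nhds hz0)
  refine (hs.comp t hz).congr_of_eventuallyEq ?_
  filter_upwards [hδz] with s h
  simp only [Function.comp]
  rw [← h.2, (chartAt (E × ℝ) p₀).left_inv h.1]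

theorem mfderiv_pt_velocity (γ : HorizontalCurve D ε) {t : ℝ} (ht : t ∈ Ioo (-ε) ε) :
    mfderiv 𝓘(ℝ, E × ℝ) 𝓘(ℝ, E) (ProjD.pt : ProjD D → M)
      (ProjD.ofVec D (γ.toFun t) (velocity γ.toFun t))
      (velocity (fun t => ProjD.ofVec D (γ.toFun t) (velocity γ.toFun t)) t) =
    (velocity γ.toFun t : E) := by
  have h := mfderiv_comp (I := 𝓘(ℝ)) t (ProjD.mdifferentiableAt_pt
    (ProjD.ofVec D (γ.toFun t) (velocity γ.toFun t)))
    ((γ.contMDiffAt_ofVec ht).mdifferentiableAt (by simp))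
  have hc : (ProjD.pt : ProjD D → M) ∘
      (fun t => ProjD.ofVec D (γ.toFun t) (velocity γ.toFun t)) = γ.toFun := by
    funext s; exact ProjD.ofVec_pt _ _
  rw [hc] at h
  exact (congrArg (fun T => T (1 : ℝ)) h).symm

/-- The Cartan prolongation `t ↦ (γ t, [γ' t])` of a horizontal curve, a horizontal curve of the
prolonged distribution with nonvanishing derivative. -/
noncomputable def prolong (γ : HorizontalCurve D ε) : HorizontalCurve D.prolong ε where
  toFun t := ProjD.ofVec D (γ.toFun t) (velocity γ.toFun t)
  smooth _ ht := (γ.contMDiffAt_ofVec ht).contMDiffWithinAt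
  horizontal t ht := by
    refine (D.mem_prolongPlane _ _).2 ?_
    have h := γ.mfderiv_pt_velocity ht
    have key : ∀ (p : ProjD D), p = ProjD.ofVec D (γ.toFun t) (velocity γ.toFun t) →
      ∀ v : TangentSpace 𝓘(ℝ, E) p.pt, (v : E) = (velocity γ.toFun t : E) → v ∈ p.line := by
      rw [ProjD.ofVec_eq (γ.horizontal t ht) (γ.velocity_ne_zero t ht)]
      rintro _ rfl v hv
      exact Submodule.mem_span_singleton.2 ⟨1, by rw [one_smul]; exact hv.symm⟩
    exact key _ rfl _ h
  velocity_ne_zero t ht h0 := by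
    have h := γ.mfderiv_pt_velocity ht
    rw [h0, map_zero] at h
    exact γ.velocity_ne_zero t ht h.symm

/-- A horizontal curve, as a curve smooth near `0` with nonzero velocity at `0`. -/
def toRegularCurve (γ : HorizontalCurve D ε) (hε : 0 < ε) : RegularCurve E M where
  toFun := γ.toFun
  smooth := by
    filter_upwards [Ioo_mem_nhds (neg_lt_zero.2 hε) hε] with t ht
    exact γ.smooth.contMDiffAt (isOpen_Ioo.mem_nhds ht)
  velocity_ne_zero := γ.velocity_ne_zero 0 ⟨neg_lt_zero.2 hε, hε⟩

end HorizontalCurve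

end Distribution

section Iteration

/-- A finite-dimensional smooth manifold `carrier`, modelled on `E`, with a smooth rank 2 distribution
`D`. -/
structure DistributedManifold where
  E : Type
  carrier : Type u
  [normedAddCommGroup : NormedAddCommGroup E]
  [normedSpace : NormedSpace ℝ E]
  [finiteDimensional : FiniteDimensional ℝ E]
  [topologicalSpace : TopologicalSpace carrier]
  [chartedSpace : ChartedSpace E carrier]
  [isManifold : IsManifold 𝓘(ℝ, E) ∞ carrier]
  D : RankTwoDistribution E carrier

attribute [instance] DistributedManifold.normedAddCommGroup DistributedManifold.normedSpace
  DistributedManifold.finiteDimensional DistributedManifold.topologicalSpace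
  DistributedManifold.chartedSpace DistributedManifold.isManifold

variable {E : Type} [NormedAddCommGroup E] [NormedSpace ℝ E] [FiniteDimensional ℝ E]
  {M : Type u} [TopologicalSpace M] [ChartedSpace E M] [IsManifold 𝓘(ℝ, E) ∞ M]

/-- The iterated prolongations `(M_k, pr^k D)`, where `M_0 = M`, `pr^0 D = D`,
`M_(k+1) = ℙ(pr^k D)` and `pr^(k+1) D = pr (pr^k D)`. -/
noncomputable def RankTwoDistribution.iterProlong (D : RankTwoDistribution E M) :
    ℕ → DistributedManifold.{u}
  | 0 => ⟨E, M, D⟩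
  | k + 1 => ⟨(D.iterProlong k).E × ℝ, ProjD (D.iterProlong k).D, (D.iterProlong k).D.prolong⟩

/-- The iterated prolongations `pr^k γ` of a horizontal curve `γ`, where `pr^0 γ = γ` and
`pr^(k+1) γ = pr (pr^k γ)`. -/
noncomputable def HorizontalCurve.iterProlong {D : RankTwoDistribution E M} {ε : ℝ}
    (γ : HorizontalCurve D ε) : ∀ k : ℕ, HorizontalCurve (D.iterProlong k).D ε
  | 0 => γ
  | k + 1 => (γ.iterProlong k).prolong

end Iteration

end CartanProlongation

open CartanProlongation

/-! The heart of the matter is one exchange: for horizontal curves, raising the order of contact by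
one is the same as prolonging once (`HorizontalCurve.unparamJet_succ_eq_iff`). Applied `k` times it
turns `k`-jets of `γ₁`, `γ₂` into `0`-jets of `pr^k γ₁`, `pr^k γ₂`, and a `0`-jet is just a point.

For the exchange, choose a frame `(X, Y)` of `D` adapted to the common prolonged point. In the chart
`(q, ℝ (X + s Y)) ↦ (φ q, s)` of `ℙD` a prolonged curve reads `(x, s)`, where `x` is the original
curve in the chart and `x' = a (X(x) + s Y(x))` with `a ≠ 0`. What remains is a statement about
curves in a vector space, `IsDirected.exists_jetEq_iff`.

From `x` to `(x, s)`: by Cramer's rule `s` is a smooth function of `(x, x')`, so the `(k+1)`-jet of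
`x` determines the `k`-jet of `s` (`IsDirected.jetEq_slope`).

From `(x, s)` to `x`: the `k`-jet of `(x, s)` does not control the speed `a` to order `k`, so the
parameter has to be normalized. Take a linear functional `f` with `f (X + s Y) ≠ 0` at the base
point and use `f(x) - f(x₀)` as the parameter. Then `a = 1 / f(X + s Y)`, hence `x'` is a smooth
function of `(x, s)` and its `k`-jet is known (`IsDirected.jetEq_succ`). Since `f` is a function of
`x`, both curves are normalized by reparameterizations compatible to order `k` with the given
matching; this is cancellation in the group `G^k` (`Reparam.setoid_of_comp_eq_id`). -/

namespace CartanProlongation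

universe u v

/-! ### Calculus of jets of curves in normed spaces. -/

section JetCalculus

variable {E : Type*} [NormedAddCommGroup E] [NormedSpace ℝ E]
  {F : Type*} [NormedAddCommGroup F] [NormedSpace ℝ F]

/-- Two curves in a normed space have the same `k`-jet at `0`. -/
def JetEq (k : ℕ) (f g : ℝ → E) : Prop := ∀ i ≤ k, iteratedDeriv i f 0 = iteratedDeriv i g 0

namespace JetEq

variable {k : ℕ} {f g h : ℝ → E}

theorem refl (f : ℝ → E) : JetEq k f f := fun _ _ => rfl

theorem symm (hfg : JetEq k f g) : JetEq k g f := fun i hi => (hfg i hi).symm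

theorem trans (hfg : JetEq k f g) (hgh : JetEq k g h) : JetEq k f h :=
  fun i hi => (hfg i hi).trans (hgh i hi)

theorem of_eventuallyEq (hfg : f =ᶠ[𝓝 0] g) : JetEq k f g := fun i _ => hfg.iteratedDeriv_eq i

theorem mono {l : ℕ} (hlk : l ≤ k) (hfg : JetEq k f g) : JetEq l f g :=
  fun i hi => hfg i (hi.trans hlk)

theorem apply_zero (hfg : JetEq k f g) : f 0 = g 0 := by simpa using hfg 0 (Nat.zero_le k)

theorem succ_iff : JetEq (k + 1) f g ↔ f 0 = g 0 ∧ JetEq k (deriv f) (deriv g) := by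
  constructor
  · intro hfg
    refine ⟨hfg.apply_zero, fun i hi => ?_⟩
    simpa only [iteratedDeriv_succ'] using hfg (i + 1) (by lia)
  · rintro ⟨h0, h1⟩ i hi
    cases i with
    | zero => simpa using h0
    | succ i =>
      rw [iteratedDeriv_succ', iteratedDeriv_succ']
      exact h1 i (by lia)

/-- By Faà di Bruno's formula the `i`-th derivative of `G ∘ f` at `0` involves only derivatives of
`G` at `f 0` and derivatives of `f` at `0` of order at most `i`; the two base points coincide
because `0`-jets do. -/
theorem map {G : E → F} (hG : ContDiffAt ℝ ∞ G (f 0)) (hf : ContDiffAt ℝ ∞ f 0)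
    (hg : ContDiffAt ℝ ∞ g 0) (hfg : JetEq k f g) : JetEq k (G ∘ f) (G ∘ g) := by
  intro i hi
  have hn : (i : WithTop ℕ∞) ≤ ∞ := by exact_mod_cast le_top
  have h0 := hfg.apply_zero
  rw [iteratedDeriv_vcomp_eq_sum_orderedFinpartition (hG.of_le hn) (hf.of_le hn) le_rfl,
    iteratedDeriv_vcomp_eq_sum_orderedFinpartition (h0 ▸ hG.of_le hn) (hg.of_le hn) le_rfl, ← h0]
  refine Finset.sum_congr rfl fun c _ => ?_
  congr 1
  funext m
  exact hfg _ ((c.partSize_le m).trans hi)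

theorem prodMk {f' g' : ℝ → F} (hf : ContDiffAt ℝ ∞ f 0) (hg : ContDiffAt ℝ ∞ g 0)
    (hf' : ContDiffAt ℝ ∞ f' 0) (hg' : ContDiffAt ℝ ∞ g' 0) (h : JetEq k f g) (h' : JetEq k f' g') :
    JetEq k (fun t => (f t, f' t)) (fun t => (g t, g' t)) := by
  intro i hi
  have hn : (i : WithTop ℕ∞) ≤ ∞ := by exact_mod_cast le_top
  rw [← iteratedFDeriv_eq_iff, iteratedFDeriv_prodMk hf hf' hn, iteratedFDeriv_prodMk hg hg' hn,
    iteratedFDeriv_eq_iff.2 (h i hi), iteratedFDeriv_eq_iff.2 (h' i hi)]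

theorem prodMk_iff {f' g' : ℝ → F} (hf : ContDiffAt ℝ ∞ f 0) (hg : ContDiffAt ℝ ∞ g 0)
    (hf' : ContDiffAt ℝ ∞ f' 0) (hg' : ContDiffAt ℝ ∞ g' 0) :
    JetEq k (fun t => (f t, f' t)) (fun t => (g t, g' t)) ↔ JetEq k f g ∧ JetEq k f' g' :=
  ⟨fun h => ⟨h.map contDiffAt_fst (hf.prodMk hf') (hg.prodMk hg'),
    h.map contDiffAt_snd (hf.prodMk hf') (hg.prodMk hg')⟩,
    fun h => prodMk hf hg hf' hg' h.1 h.2⟩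

theorem comp_reparam {φ ψ : Reparam} (hf : ContDiffAt ℝ ∞ f 0) (hg : ContDiffAt ℝ ∞ g 0)
    (hfg : JetEq k f g) (hφψ : Reparam.setoid k φ ψ) : JetEq k (f ∘ φ.toFun) (g ∘ ψ.toFun) :=
  iteratedDeriv_comp_congr φ.map_zero ψ.map_zero hf hg φ.contDiffAt ψ.contDiffAt hfg hφψ

end JetEq

theorem contDiffAt_deriv {f : ℝ → E} {t : ℝ} (hf : ContDiffAt ℝ ∞ f t) :
    ContDiffAt ℝ ∞ (deriv f) t :=
  (hf.fderiv_right (m := ∞) (by simp)).clm_apply contDiffAt_const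

theorem _root_.ContDiffAt.comp_reparam {f : ℝ → E} (hf : ContDiffAt ℝ ∞ f 0) (φ : Reparam) :
    ContDiffAt ℝ ∞ (f ∘ φ.toFun) 0 :=
  ContDiffAt.comp 0 (by rwa [φ.map_zero]) φ.contDiffAt

theorem Reparam.comp_apply_zero {α : Type*} (f : ℝ → α) (φ : Reparam) : (f ∘ φ.toFun) 0 = f 0 :=
  congrArg f φ.map_zero

/-- Precomposing both sides with the right inverse `χ` of `φ` moves the whole reparameterization
onto the second curve. -/
theorem JetEq.of_comp_left {k : ℕ} {f g : ℝ → E} {φ ψ χ : Reparam} (hf : ContDiffAt ℝ ∞ f 0)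
    (hg : ContDiffAt ℝ ∞ g 0) (h : JetEq k (f ∘ φ.toFun) (g ∘ ψ.toFun))
    (hχ : φ.toFun ∘ χ.toFun =ᶠ[𝓝 0] fun t => t) : JetEq k f (g ∘ (ψ.comp χ).toFun) := by
  refine (JetEq.of_eventuallyEq ?_).trans (JetEq.comp_reparam (g := g ∘ ψ.toFun) (hf.comp_reparam φ) (hg.comp_reparam ψ) h
    ((Reparam.setoid k).refl χ))
  filter_upwards [hχ] with t ht
  exact congrArg f ht.symm

end JetCalculus

/-! ### Curves in a vector space with prescribed direction `X + s Y`. -/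

section Directed

variable {E : Type*} [NormedAddCommGroup E] [NormedSpace ℝ E]
  {X Y : E → E} {x x₁ x₂ : ℝ → E} {s s₁ s₂ : ℝ → ℝ} {x₀ : E} {k : ℕ}

/-- Near `0`, the curve `x` has nonzero velocity of direction `X + s Y`. -/
def IsDirected (X Y : E → E) (x : ℝ → E) (s : ℝ → ℝ) : Prop :=
  ∀ᶠ t in 𝓝 (0 : ℝ), ∃ a : ℝ, a ≠ 0 ∧ HasDerivAt x (a • (X (x t) + s t • Y (x t))) t

/-- The chain rule only multiplies the speed `a` by `φ'(t)`, which is nonzero near `0`. No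
regularity of the speed in `t` has to be checked, as it is quantified at each time separately. -/
theorem IsDirected.comp (h : IsDirected X Y x s) (φ : Reparam) :
    IsDirected X Y (x ∘ φ.toFun) (s ∘ φ.toFun) := by
  have hne : ∀ᶠ t in 𝓝 (0 : ℝ), deriv φ.toFun t ≠ 0 :=
    (contDiffAt_deriv φ.contDiffAt).continuousAt.eventually_ne φ.deriv_ne_zero
  filter_upwards [φ.tendsto.eventually h, φ.smooth, hne] with t ⟨a, ha, hx⟩ h2 h3
  refine ⟨deriv φ.toFun t * a, mul_ne_zero h3 ha, ?_⟩
  rw [mul_smul]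
  exact hx.scomp t (h2.differentiableAt (by simp)).hasDerivAt

/-- The slope of a directed curve is a smooth function of its position and velocity, hence its `k`-jet is
determined by the `k + 1`-jet of the curve. -/
theorem IsDirected.jetEq_slope [FiniteDimensional ℝ E] (hX : ContDiffAt ℝ ∞ X x₀)
    (hY : ContDiffAt ℝ ∞ Y x₀) (hXY : LinearIndependent ℝ ![X x₀, Y x₀])
    (h₁ : IsDirected X Y x₁ s₁) (h₂ : IsDirected X Y x₂ s₂) (hx₁ : ContDiffAt ℝ ∞ x₁ 0)
    (hx₂ : ContDiffAt ℝ ∞ x₂ 0) (h0 : x₁ 0 = x₀) (h : JetEq (k + 1) x₁ x₂) : JetEq k s₁ s₂ := by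
  -- The functionals `f`, `g` are dual to `X x₀`, `Y x₀`; the `2 × 2` determinant they define equals
  -- `1` on that pair and so stays nonzero on `(X, Y)` nearby.
  obtain ⟨f, g, f1, f2, g1, g2⟩ := exists_dual_pair hXY
  let det : E → E → ℝ := fun u v => f u * g v - g u * f v
  have hdet : ∀ (a b : E × E → E) (z : E × E), ContDiffAt ℝ ∞ a z → ContDiffAt ℝ ∞ b z →
      ContDiffAt ℝ ∞ (fun z => det (a z) (b z)) z := fun a b z ha hb =>
    ((f.contDiff.contDiffAt.comp z ha).mul (g.contDiff.contDiffAt.comp z hb)).sub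
      ((g.contDiff.contDiffAt.comp z ha).mul (f.contDiff.contDiffAt.comp z hb))
  -- Cramer's rule: for `x' = a (X + s Y)` the numerator is `a s det(X, Y)` and the denominator is
  -- `a det(X, Y)`, so the quotient is `s` and the unknown speed drops out.
  let S : E × E → ℝ := fun z => det (X z.1) z.2 / det z.2 (Y z.1)
  have hS : ∀ {x : ℝ → E} {s : ℝ → ℝ}, IsDirected X Y x s → ContDiffAt ℝ ∞ x 0 → x 0 = x₀ →
      s =ᶠ[𝓝 0] S ∘ fun t => (x t, deriv x t) := by
    intro x s hd hx hx0
    have hne : ∀ᶠ t in 𝓝 (0 : ℝ), det (X (x t)) (Y (x t)) ≠ 0 := by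
      have hc : ContinuousAt (fun t => det (X (x t)) (Y (x t))) 0 := by
        have hXc : ContinuousAt (fun t => X (x t)) 0 :=
          ContinuousAt.comp (g := X) (by rw [hx0]; exact hX.continuousAt) hx.continuousAt
        have hYc : ContinuousAt (fun t => Y (x t)) 0 :=
          ContinuousAt.comp (g := Y) (by rw [hx0]; exact hY.continuousAt) hx.continuousAt
        exact ((f.continuous.continuousAt.comp hXc).mul (g.continuous.continuousAt.comp hYc)).sub
          ((g.continuous.continuousAt.comp hXc).mul (f.continuous.continuousAt.comp hYc))
      refine hc.eventually_ne ?_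
      simp only [hx0, det, f1, f2, g1, g2]
      norm_num
    filter_upwards [hd, hne] with t ⟨a, ha, ht⟩ hdt
    have hfst : det (X (x t)) (deriv x t) = a * s t * det (X (x t)) (Y (x t)) := by
      simp only [det, ht.deriv, map_smul, map_add, smul_eq_mul]; ring
    have hsnd : det (deriv x t) (Y (x t)) = a * det (X (x t)) (Y (x t)) := by
      simp only [det, ht.deriv, map_smul, map_add, smul_eq_mul]; ring
    change s t = det (X (x t)) (deriv x t) / det (deriv x t) (Y (x t))
    rw [hfst, hsnd]
    field_simp
  -- At time `0` the denominator of `S` is the speed `a` itself, because `det (X x₀) (Y x₀) = 1`.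
  have hv : det (deriv x₁ 0) (Y x₀) ≠ 0 := by
    obtain ⟨a, ha, ht⟩ := h₁.self_of_nhds
    rw [ht.deriv, h0]
    simpa [det, f1, f2, g1, g2] using ha
  have hSs : ContDiffAt ℝ ∞ S (x₁ 0, deriv x₁ 0) := by
    rw [h0]
    refine (hdet _ _ _ ?_ contDiffAt_snd).div (hdet _ _ _ contDiffAt_snd ?_) hv
    · exact ContDiffAt.comp (g := X) _ hX contDiffAt_fst
    · exact ContDiffAt.comp (g := Y) _ hY contDiffAt_fst
  have h' := (JetEq.prodMk hx₁ hx₂ (contDiffAt_deriv hx₁) (contDiffAt_deriv hx₂)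
    (h.mono k.le_succ) (JetEq.succ_iff.1 h).2).map hSs (hx₁.prodMk (contDiffAt_deriv hx₁))
    (hx₂.prodMk (contDiffAt_deriv hx₂))
  exact (JetEq.of_eventuallyEq (hS h₁ hx₁ h0)).trans
    (h'.trans (JetEq.of_eventuallyEq (hS h₂ hx₂ (h.apply_zero ▸ h0))).symm)

/-- A directed curve parameterized by a linear coordinate solves an ordinary differential equation whose
right hand side depends on the position and the slope. -/
theorem IsDirected.jetEq_succ (hX : ContDiffAt ℝ ∞ X x₀) (hY : ContDiffAt ℝ ∞ Y x₀)
    (h₁ : IsDirected X Y x₁ s₁) (h₂ : IsDirected X Y x₂ s₂) (hx₁ : ContDiffAt ℝ ∞ x₁ 0)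
    (hx₂ : ContDiffAt ℝ ∞ x₂ 0) (hs₁ : ContDiffAt ℝ ∞ s₁ 0) (hs₂ : ContDiffAt ℝ ∞ s₂ 0)
    (h0 : x₁ 0 = x₀) {f : E →L[ℝ] ℝ} {c : ℝ} (hf : f (X x₀ + s₁ 0 • Y x₀) ≠ 0)
    (hf₁ : ∀ᶠ t in 𝓝 (0 : ℝ), f (x₁ t) = c + t) (hf₂ : ∀ᶠ t in 𝓝 (0 : ℝ), f (x₂ t) = c + t)
    (hx : JetEq k x₁ x₂) (hs : JetEq k s₁ s₂) : JetEq (k + 1) x₁ x₂ := by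
  let V : E × ℝ → E := fun z => X z.1 + z.2 • Y z.1
  -- Differentiating `f(x(t)) = c + t` gives `a f(V) = 1`, which fixes the speed as `(f V)⁻¹`; thus
  -- `x' = G(x, s)`.
  let G : E × ℝ → E := fun z => (f (V z))⁻¹ • V z
  have hG : ∀ {x : ℝ → E} {s : ℝ → ℝ}, IsDirected X Y x s → (∀ᶠ t in 𝓝 (0 : ℝ), f (x t) = c + t) →
      deriv x =ᶠ[𝓝 0] G ∘ fun t => (x t, s t) := by
    intro x s hd hfx
    -- The normalization is differentiated at `t`, so it is needed on a neighbourhood of each nearby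
    -- `t`, not only at `t`.
    filter_upwards [hd, hfx.eventually_nhds] with t ⟨a, ha, ht⟩ hft
    have h1 : HasDerivAt (fun t => f (x t)) (f (a • V (x t, s t))) t := f.hasFDerivAt.comp_hasDerivAt t ht
    have h2 : HasDerivAt (fun t => f (x t)) 1 t :=
      ((hasDerivAt_id t).const_add c).congr_of_eventuallyEq hft
    have h3 := h1.unique h2
    rw [map_smul, smul_eq_mul] at h3
    change deriv x t = (f (V (x t, s t)))⁻¹ • V (x t, s t)
    rw [ht.deriv, ← eq_inv_of_mul_eq_one_left h3]
  have hGs : ContDiffAt ℝ ∞ G (x₁ 0, s₁ 0) := by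
    rw [h0]
    have hV : ContDiffAt ℝ ∞ V (x₀, s₁ 0) :=
      (ContDiffAt.comp (g := X) _ hX contDiffAt_fst).add
        (contDiffAt_snd.smul (ContDiffAt.comp (g := Y) _ hY contDiffAt_fst))
    exact ((f.contDiff.contDiffAt.comp _ hV).inv hf).smul hV
  refine JetEq.succ_iff.2 ⟨hx.apply_zero, ?_⟩
  exact (JetEq.of_eventuallyEq (hG h₁ hf₁)).trans
    (((JetEq.prodMk hx₁ hx₂ hs₁ hs₂ hx hs).map hGs (hx₁.prodMk hs₁) (hx₂.prodMk hs₂)).trans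
      (JetEq.of_eventuallyEq (hG h₂ hf₂)).symm)

/-- A directed curve admits a reparameterization by a linear coordinate not vanishing on its
direction at `0`. -/
theorem IsDirected.exists_reparam (h : IsDirected X Y x s)
    (hx : ∀ᶠ t in 𝓝 (0 : ℝ), ContDiffAt ℝ ∞ x t) {f : E →L[ℝ] ℝ}
    (hf : f (X (x 0) + s 0 • Y (x 0)) ≠ 0) :
    ∃ τ ψ : Reparam, (∀ t, τ.toFun t = f (x t) - f (x 0)) ∧ τ.toFun ∘ ψ.toFun =ᶠ[𝓝 0] fun t => t := by
  obtain ⟨a, ha, ht⟩ := h.self_of_nhds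
  -- The coordinate `f` along the curve, translated to vanish at `0`; its derivative there is `a`
  -- times the value of `f` on the direction. In the parameter of the right inverse `ψ`, the
  -- function `f ∘ x` becomes `f (x 0) + t`.
  let τ : Reparam :=
    { toFun := fun t => f (x t) - f (x 0)
      smooth := by
        filter_upwards [hx] with t ht using (f.contDiff.contDiffAt.comp t ht).sub contDiffAt_const
      map_zero := sub_self _
      deriv_ne_zero := by
        have h1 : HasDerivAt (fun t => f (x t) - f (x 0)) (f (a • (X (x 0) + s 0 • Y (x 0)))) 0 :=
          (f.hasFDerivAt.comp_hasDerivAt 0 ht).sub_const _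
        rw [h1.deriv, map_smul]
        exact smul_ne_zero ha hf }
  exact ⟨τ, τ.exists_inverse.choose, fun _ => rfl, τ.exists_inverse.choose_spec⟩

/-- Both `τ ∘ φ` and `τ ∘ ψ` have the `k`-jet of the identity, so the `k`-jet of `τ` can be
cancelled on the left in the group `G^k`. -/
theorem Reparam.setoid_of_comp_eq_id {τ φ ψ : Reparam} (hψ : τ.toFun ∘ ψ.toFun =ᶠ[𝓝 0] fun t => t)
    (hφ : JetEq k (τ.toFun ∘ φ.toFun) fun t => t) : Reparam.setoid k φ ψ := by
  have h : (JetGroup.mk τ * JetGroup.mk φ : JetGroup k) = JetGroup.mk τ * JetGroup.mk ψ :=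
    Quotient.sound (hφ.trans (JetEq.of_eventuallyEq hψ).symm)
  have h' : (JetGroup.mk φ : JetGroup k) = JetGroup.mk ψ := mul_left_cancel h
  exact Quotient.exact h'

/-- The unparameterized `k + 1`-jet of a directed curve and the unparameterized `k`-jet of the pair
formed by the curve and its slope determine each other. -/
theorem IsDirected.exists_jetEq_iff [FiniteDimensional ℝ E] (hX : ContDiffAt ℝ ∞ X x₀)
    (hY : ContDiffAt ℝ ∞ Y x₀) (hXY : LinearIndependent ℝ ![X x₀, Y x₀])
    (h₁ : IsDirected X Y x₁ s₁) (h₂ : IsDirected X Y x₂ s₂)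
    (hx₁ : ∀ᶠ t in 𝓝 (0 : ℝ), ContDiffAt ℝ ∞ x₁ t) (hx₂ : ∀ᶠ t in 𝓝 (0 : ℝ), ContDiffAt ℝ ∞ x₂ t)
    (hs₁ : ContDiffAt ℝ ∞ s₁ 0) (hs₂ : ContDiffAt ℝ ∞ s₂ 0) (h0 : x₁ 0 = x₀) :
    (∃ φ ψ : Reparam, JetEq (k + 1) (x₁ ∘ φ.toFun) (x₂ ∘ ψ.toFun)) ↔
      ∃ φ ψ : Reparam, JetEq k ((fun t => (x₁ t, s₁ t)) ∘ φ.toFun) ((fun t => (x₂ t, s₂ t)) ∘ ψ.toFun) := by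
  have sx₁ := hx₁.self_of_nhds
  have sx₂ := hx₂.self_of_nhds
  have key : ∀ φ ψ : Reparam,
      JetEq k ((fun t => (x₁ t, s₁ t)) ∘ φ.toFun) ((fun t => (x₂ t, s₂ t)) ∘ ψ.toFun) ↔
      JetEq k (x₁ ∘ φ.toFun) (x₂ ∘ ψ.toFun) ∧ JetEq k (s₁ ∘ φ.toFun) (s₂ ∘ ψ.toFun) := fun φ ψ =>
    JetEq.prodMk_iff (sx₁.comp_reparam φ) (sx₂.comp_reparam ψ) (hs₁.comp_reparam φ)
      (hs₂.comp_reparam ψ)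
  constructor
  · rintro ⟨φ, ψ, h⟩
    refine ⟨φ, ψ, (key φ ψ).2 ⟨h.mono k.le_succ, ?_⟩⟩
    exact IsDirected.jetEq_slope hX hY hXY (h₁.comp φ) (h₂.comp ψ) (sx₁.comp_reparam φ)
      (sx₂.comp_reparam ψ) ((Reparam.comp_apply_zero x₁ φ).trans h0) h
  · rintro ⟨φ, ψ, h⟩
    obtain ⟨hx, hs⟩ := (key φ ψ).1 h
    have ex : x₁ 0 = x₂ 0 := by simpa [φ.map_zero, ψ.map_zero] using hx.apply_zero
    have es : s₁ 0 = s₂ 0 := by simpa [φ.map_zero, ψ.map_zero] using hs.apply_zero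
    have hw : X x₀ + s₁ 0 • Y x₀ ≠ 0 := fun hw => by
      have := LinearIndependent.pair_iff.1 hXY 1 (s₁ 0) (by rwa [one_smul])
      exact one_ne_zero this.1
    -- A single `f` serves both curves, since their positions and slopes at `0` coincide.
    obtain ⟨f, hf⟩ := SeparatingDual.exists_ne_zero (R := ℝ) hw
    obtain ⟨τ₁, ψ₁, hτ₁, hψ₁⟩ := h₁.exists_reparam hx₁ (f := f) (by rwa [h0])
    obtain ⟨τ₂, ψ₂, hτ₂, hψ₂⟩ := h₂.exists_reparam hx₂ (f := f) (by rwa [← ex, ← es, h0])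
    obtain ⟨χ, hχ⟩ := φ.exists_inverse
    -- Parameter of the second curve that corresponds, under the given matching, to the normalized
    -- parameter `ψ₁` of the first.
    set θ := (ψ.comp χ).comp ψ₁
    have hxθ : JetEq k (x₁ ∘ ψ₁.toFun) (x₂ ∘ θ.toFun) :=
      JetEq.comp_reparam (g := x₂ ∘ (ψ.comp χ).toFun) sx₁ (sx₂.comp_reparam (ψ.comp χ))
        (hx.of_comp_left sx₁ sx₂ hχ) ((Reparam.setoid k).refl ψ₁)
    have hsθ : JetEq k (s₁ ∘ ψ₁.toFun) (s₂ ∘ θ.toFun) :=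
      JetEq.comp_reparam (g := s₂ ∘ (ψ.comp χ).toFun) hs₁ (hs₂.comp_reparam (ψ.comp χ))
        (hs.of_comp_left hs₁ hs₂ hχ) ((Reparam.setoid k).refl ψ₁)
    -- Up to order `k`, `τ₂ ∘ θ = f ∘ x₂ ∘ θ - f x₀` agrees with `f ∘ x₁ ∘ ψ₁ - f x₀ = τ₁ ∘ ψ₁`,
    -- which is the identity near `0`. So `θ` normalizes `x₂` to order `k`, as `ψ₂` does exactly.
    have hθ : Reparam.setoid k θ ψ₂ := by
      refine Reparam.setoid_of_comp_eq_id hψ₂ ?_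
      have hfc : ContDiffAt ℝ ∞ (fun y => f y - f x₀) ((x₁ ∘ ψ₁.toFun) 0) :=
        f.contDiff.contDiffAt.sub contDiffAt_const
      have h1 := (hxθ.map hfc (sx₁.comp_reparam ψ₁) (sx₂.comp_reparam θ)).symm
      have e₁ : (fun y => f y - f x₀) ∘ (x₁ ∘ ψ₁.toFun) = τ₁.toFun ∘ ψ₁.toFun := by
        funext t; simp [hτ₁, h0]
      have e₂ : (fun y => f y - f x₀) ∘ (x₂ ∘ θ.toFun) = τ₂.toFun ∘ θ.toFun := by
        funext t; simp [hτ₂, ← ex, h0]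
      rw [e₁, e₂] at h1
      exact h1.trans (JetEq.of_eventuallyEq hψ₁)
    refine ⟨ψ₁, ψ₂, ?_⟩
    -- The differential equation needs an exact normalization, so `θ` is replaced by `ψ₂`; this
    -- costs nothing at the level of `k`-jets.
    refine IsDirected.jetEq_succ hX hY (h₁.comp ψ₁) (h₂.comp ψ₂) (sx₁.comp_reparam ψ₁)
      (sx₂.comp_reparam ψ₂) (hs₁.comp_reparam ψ₁) (hs₂.comp_reparam ψ₂)
      ((Reparam.comp_apply_zero x₁ ψ₁).trans h0) (f := f) (c := f x₀) ?_ ?_ ?_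
      (hxθ.trans (((JetEq.refl x₂).comp_reparam sx₂ sx₂) hθ))
      (hsθ.trans (((JetEq.refl s₂).comp_reparam hs₂ hs₂) hθ))
    · rwa [Reparam.comp_apply_zero]
    · filter_upwards [hψ₁] with t ht
      simp only [Function.comp, hτ₁, h0] at ht ⊢
      linear_combination ht
    · filter_upwards [hψ₂] with t ht
      simp only [Function.comp, hτ₂, ← ex, h0] at ht ⊢
      linear_combination ht

end Directed

/-! ### Unparameterized jets, vector fields and velocities in charts. -/

section ChartFields

variable {E : Type v} [NormedAddCommGroup E] [NormedSpace ℝ E]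
  {M : Type u} [TopologicalSpace M] [ChartedSpace E M]

/-- An orbit relation supplies a reparameterization of one curve only. Allowing one on each side
changes nothing, as `γ.comp φ` lies in the orbit of `γ`, and it gives a symmetric condition. -/
theorem RegularCurve.unparamJet_eq_iff [IsManifold 𝓘(ℝ, E) ∞ M] {k : ℕ} {γ δ : RegularCurve E M} :
    γ.unparamJet k = δ.unparamJet k ↔
      ∃ φ ψ : Reparam, RegularCurve.setoid E M k (γ.comp φ) (δ.comp ψ) := by
  have hsmul : ∀ (γ : RegularCurve E M) (φ : Reparam),
      (γ.comp φ).jet k = MulOpposite.op (JetGroup.mk φ : JetGroup k) • γ.jet k := fun _ _ => rfl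
  have hcomp : ∀ (γ : RegularCurve E M) (φ : Reparam), (γ.comp φ).unparamJet k = γ.unparamJet k :=
    fun γ φ => Quotient.sound ⟨MulOpposite.op (JetGroup.mk φ), (hsmul γ φ).symm⟩
  constructor
  · intro h
    obtain ⟨⟨⟨φ⟩⟩, hφ⟩ := Quotient.exact h
    refine ⟨Reparam.id, φ, ?_⟩
    exact Quotient.exact (hφ.symm : γ.jet k = (δ.comp φ).jet k)
  · rintro ⟨φ, ψ, h⟩
    rw [← hcomp γ φ, ← hcomp δ ψ]
    exact congrArg (Quotient.mk (MulAction.orbitRel (JetGroup k)ᵐᵒᵖ (RegularJet E M k)))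
      (Quotient.sound h)

/-- Keeping the centre `x` of the chart as a variable allows it to be the base point of a point of
`ℙD`, which equals `γ 0` only propositionally. -/
theorem RegularCurve.unparamJet_eq_iff_jetEq [IsManifold 𝓘(ℝ, E) ∞ M] {k : ℕ}
    {γ δ : RegularCurve E M} {x : M} (hx : γ.toFun 0 = x) :
    γ.unparamJet k = δ.unparamJet k ↔ δ.toFun 0 = x ∧
      ∃ φ ψ : Reparam, JetEq k ((chartAt E x ∘ γ.toFun) ∘ φ.toFun)
        ((chartAt E x ∘ δ.toFun) ∘ ψ.toFun) := by
  rw [RegularCurve.unparamJet_eq_iff, ← exists_and_left]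
  refine exists_congr fun φ => ?_
  rw [← exists_and_left]
  refine exists_congr fun ψ => ?_
  have e : (γ.comp φ).toFun 0 = x := (congrArg γ.toFun φ.map_zero).trans hx
  have e' : (δ.comp ψ).toFun 0 = δ.toFun 0 := congrArg δ.toFun ψ.map_zero
  change (γ.comp φ).toFun 0 = (δ.comp ψ).toFun 0 ∧ JetEq k (chartAt E ((γ.comp φ).toFun 0) ∘ _) _ ↔ _
  rw [e, e', eq_comm (a := x)]
  rfl

/-- A vector field, read in the preferred chart at `x`. -/
noncomputable def chartField (x : M) [IsManifold 𝓘(ℝ, E) 1 M] (V : ∀ q : M, TangentSpace 𝓘(ℝ, E) q)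
    (y : E) : E :=
  (trivializationAt E (TangentSpace 𝓘(ℝ, E)) x
    (⟨(chartAt E x).symm y, V ((chartAt E x).symm y)⟩ : TangentBundle 𝓘(ℝ, E) M)).2

variable [IsManifold 𝓘(ℝ, E) ∞ M]

theorem chartField_chartAt {x q : M} (hq : q ∈ (chartAt E x).source)
    (V : ∀ q : M, TangentSpace 𝓘(ℝ, E) q) : chartField x V (chartAt E x q) =
      (trivializationAt E (TangentSpace 𝓘(ℝ, E)) x).continuousLinearMapAt ℝ q (V q) := by
  rw [Bundle.Trivialization.continuousLinearMapAt_apply_of_mem _ _ hq, chartField,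
    (chartAt E x).left_inv hq]

theorem contDiffAt_chartField {x q : M} (hq : q ∈ (chartAt E x).source)
    {V : ∀ q : M, TangentSpace 𝓘(ℝ, E) q} (hV : ContMDiffAt 𝓘(ℝ, E) 𝓘(ℝ, E).tangent ∞
      (fun q => (⟨q, V q⟩ : TangentBundle 𝓘(ℝ, E) M)) q) :
    ContDiffAt ℝ ∞ (chartField x V) (chartAt E x q) := by
  have h1 := ((trivializationAt E (TangentSpace 𝓘(ℝ, E)) x).contMDiffAt_section_iff
    (IB := 𝓘(ℝ, E)) (n := ∞) (s := V) hq).1 hV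
  have h2 := (contMDiffOn_chart_symm (I := 𝓘(ℝ, E)) (n := ∞) (x := x)).contMDiffAt
    ((chartAt E x).open_target.mem_nhds ((chartAt E x).map_source hq))
  rw [← (chartAt E x).left_inv hq] at h1
  exact (h1.comp _ h2).contDiffAt

theorem injective_continuousLinearMapAt {x q : M} (hq : q ∈ (chartAt E x).source) :
    Function.Injective ((trivializationAt E (TangentSpace 𝓘(ℝ, E)) x).continuousLinearMapAt ℝ q) :=
  Function.LeftInverse.injective fun v =>
    (trivializationAt E (TangentSpace 𝓘(ℝ, E)) x).symmL_continuousLinearMapAt hq v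

/-- On the domain of the chart at `x`, the trivialization of the tangent bundle at `x` is the
differential of that chart, so this is the chain rule. -/
theorem hasDerivAt_chart_comp {γ : ℝ → M} {t : ℝ} (hγ : MDifferentiableAt 𝓘(ℝ) 𝓘(ℝ, E) γ t) {x : M}
    (hx : γ t ∈ (chartAt E x).source) : HasDerivAt (chartAt E x ∘ γ)
      ((trivializationAt E (TangentSpace 𝓘(ℝ, E)) x).continuousLinearMapAt ℝ (γ t)
        (velocity γ t)) t := by
  have hd : MDifferentiableAt 𝓘(ℝ, E) 𝓘(ℝ, E) (extChartAt 𝓘(ℝ, E) x) (γ t) :=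
    mdifferentiableAt_extChartAt hx
  have h := hd.hasMFDerivAt.comp t hγ.hasMFDerivAt
  rw [TangentBundle.continuousLinearMapAt_trivializationAt hx]
  let L : ℝ →L[ℝ] E := (mfderiv 𝓘(ℝ, E) 𝓘(ℝ, E) (extChartAt 𝓘(ℝ, E) x) (γ t)).comp
    (mfderiv 𝓘(ℝ) 𝓘(ℝ, E) γ t)
  have hL : HasFDerivAt (chartAt E x ∘ γ) L t := h.hasFDerivAt
  exact hL.hasDerivAt

variable {D : RankTwoDistribution E M}

theorem linearIndependent_chartField (F : LocalFrame D.plane) {x q : M}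
    (hq : q ∈ (chartAt E x).source) (hF : q ∈ F.U) : LinearIndependent ℝ
      ![chartField x F.X (chartAt E x q), chartField x F.Y (chartAt E x q)] := by
  have h := F.indep q hF
  rw [chartField_chartAt hq, chartField_chartAt hq]
  rw [LinearIndependent.pair_iff] at h ⊢
  intro a b hab
  refine h a b (injective_continuousLinearMapAt hq ?_)
  rw [map_add, map_smul, map_smul, map_zero]
  exact hab

/-- Vectors with proportional coordinates are proportional, because the trivialization is injective
on fibres, and so they span the same line. The points `q`, `q'` are kept apart because the types of
`v`, `v'` depend on them. -/
theorem ProjD.ofVec_eq_of_chart {x q q' : M} (hq : q ∈ (chartAt E x).source) (hqq' : q = q')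
    {v : TangentSpace 𝓘(ℝ, E) q} {v' : TangentSpace 𝓘(ℝ, E) q'} (hv : v ∈ D.plane q) (h0 : v ≠ 0)
    (hv' : v' ∈ D.plane q') (h0' : v' ≠ 0) {a b : ℝ} (ha : a ≠ 0) (hb : b ≠ 0)
    (h : a • (trivializationAt E (TangentSpace 𝓘(ℝ, E)) x).continuousLinearMapAt ℝ q v =
      b • (trivializationAt E (TangentSpace 𝓘(ℝ, E)) x).continuousLinearMapAt ℝ q' v') :
    ofVec D q v = ofVec D q' v' := by
  subst hqq'
  rw [← map_smul, ← map_smul] at h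
  have h1 := injective_continuousLinearMapAt hq h
  rw [ofVec_eq hv h0, ofVec_eq hv' h0']
  congr 1
  rw [← Submodule.span_singleton_smul_eq (IsUnit.mk0 a ha), h1,
    Submodule.span_singleton_smul_eq (IsUnit.mk0 b hb)]

end ChartFields

/-! ### Horizontal curves and their prolongations: exchanging one order of contact for one
prolongation. -/

namespace HorizontalCurve

variable {E : Type v} [NormedAddCommGroup E] [NormedSpace ℝ E]
  {M : Type u} [TopologicalSpace M] [ChartedSpace E M] [IsManifold 𝓘(ℝ, E) ∞ M]
  {D : RankTwoDistribution E M} {ε : ℝ}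

theorem eventually_mem (hε : 0 < ε) : ∀ᶠ t in 𝓝 (0 : ℝ), t ∈ Ioo (-ε) ε :=
  Ioo_mem_nhds (neg_lt_zero.2 hε) hε

theorem contMDiffAt (γ : HorizontalCurve D ε) {t : ℝ} (ht : t ∈ Ioo (-ε) ε) :
    ContMDiffAt 𝓘(ℝ) 𝓘(ℝ, E) ∞ γ.toFun t :=
  γ.smooth.contMDiffAt (isOpen_Ioo.mem_nhds ht)

theorem eventually_contDiffAt_chart (γ : HorizontalCurve D ε) (hε : 0 < ε) {x : M}
    (hx : γ.toFun 0 ∈ (chartAt E x).source) :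
    ∀ᶠ t in 𝓝 (0 : ℝ), ContDiffAt ℝ ∞ (chartAt E x ∘ γ.toFun) t := by
  have hc := (γ.contMDiffAt (eventually_mem hε).self_of_nhds).continuousAt
  filter_upwards [eventually_mem hε,
    hc.preimage_mem_nhds ((chartAt E x).open_source.mem_nhds hx)] with t ht htx
  exact (((contMDiffOn_chart (I := 𝓘(ℝ, E)) (n := ∞) (x := x)).contMDiffAt
    ((chartAt E x).open_source.mem_nhds htx)).comp t (γ.contMDiffAt ht)).contDiffAt

variable [FiniteDimensional ℝ E]

/-- In the charts of `M` and `ℙD`, the second coordinate of the prolongation of a horizontal curve is the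
slope of the velocity. -/
theorem isDirected (γ : HorizontalCurve D ε) (hε : 0 < ε) {x : M} {F : LocalFrame D.plane}
    (hx : γ.prolong.toFun 0 ∈ (ProjD.chart x F).source) :
    IsDirected (chartField x F.X) (chartField x F.Y) (chartAt E x ∘ γ.toFun)
      (ProjD.slope F ∘ γ.prolong.toFun) := by
  have ht0 := (eventually_mem hε).self_of_nhds
  have hpt : (γ.prolong.toFun 0).pt = γ.toFun 0 := ProjD.ofVec_pt _ _
  have hsrc : γ.toFun 0 ∈ (chartAt E x).source := hpt ▸ hx.1
  have hF : γ.toFun 0 ∈ F.U := hpt ▸ hx.2.1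
  have hc := (γ.contMDiffAt ht0).continuousAt
  have hev : ∀ᶠ t in 𝓝 (0 : ℝ), γ.toFun t ∈ F.U := hc.preimage_mem_nhds (F.isOpen.mem_nhds hF)
  have hspec : ∀ᶠ t in 𝓝 (0 : ℝ), velocity γ.toFun t =
      (ProjD.coeff F (γ.toFun t) (velocity γ.toFun t)).1 • F.X (γ.toFun t) +
      (ProjD.coeff F (γ.toFun t) (velocity γ.toFun t)).2 • F.Y (γ.toFun t) := by
    filter_upwards [eventually_mem hε, hev] with t ht htF
    exact ProjD.coeff_spec F htF (γ.horizontal t ht)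
  -- Lying in the chart of `ℙD` means exactly that the `X`-coefficient of the velocity is nonzero;
  -- by continuity this persists near `0`, and this coefficient is the speed `a`.
  have hne := ((ProjD.mem_source_ofVec_iff x F hF (γ.velocity_ne_zero 0 ht0)
    hspec.self_of_nhds).1 hx).2
  have ha := (F.contMDiffAt_coeff (contMDiffAt_velocity isOpen_Ioo γ.smooth ht0) hF hspec).1
  filter_upwards [eventually_mem hε, hev, hspec, ha.continuousAt.eventually_ne hne,
    hc.preimage_mem_nhds ((chartAt E x).open_source.mem_nhds hsrc)] with t h1 h2 h3 h4 h5
  refine ⟨_, h4, ?_⟩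
  have hd := hasDerivAt_chart_comp ((γ.contMDiffAt h1).mdifferentiableAt (by simp)) h5
  have hs : (ProjD.slope F ∘ γ.prolong.toFun) t = _ := ProjD.slope_ofVec h2 h4 h3
  convert hd using 1
  rw [hs]
  simp only [Function.comp]
  rw [chartField_chartAt h5, chartField_chartAt h5]
  conv_rhs => rw [h3]
  rw [map_add, map_smul, map_smul, smul_add, smul_smul, mul_div_cancel₀ _ h4]

/-- The jets have order at least one, so the first derivatives agree: `φ'(0) v₁ = ψ'(0) v₂` in the
chart, with nonzero factors. The two velocities therefore span the same line. -/
theorem prolong_apply_zero_eq_of_jetEq {γ₁ γ₂ : HorizontalCurve D ε} (hε : 0 < ε) {k : ℕ}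
    (h0 : γ₁.toFun 0 = γ₂.toFun 0) {φ ψ : Reparam}
    (h : JetEq (k + 1) ((chartAt E (γ₁.toFun 0) ∘ γ₁.toFun) ∘ φ.toFun)
      ((chartAt E (γ₁.toFun 0) ∘ γ₂.toFun) ∘ ψ.toFun)) :
    γ₁.prolong.toFun 0 = γ₂.prolong.toFun 0 := by
  have ht0 := (eventually_mem hε).self_of_nhds
  have key : ∀ (γ : HorizontalCurve D ε) (φ : Reparam), γ.toFun 0 = γ₁.toFun 0 →
      deriv ((chartAt E (γ₁.toFun 0) ∘ γ.toFun) ∘ φ.toFun) 0 = deriv φ.toFun 0 •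
        (trivializationAt E (TangentSpace 𝓘(ℝ, E)) (γ₁.toFun 0)).continuousLinearMapAt ℝ (γ.toFun 0)
          (velocity γ.toFun 0) := by
    intro γ φ hγ
    have h1 := hasDerivAt_chart_comp ((γ.contMDiffAt ht0).mdifferentiableAt (by simp))
      (x := γ₁.toFun 0) (by rw [hγ]; exact mem_chart_source E _)
    have h2 := (φ.contDiffAt.differentiableAt (by simp)).hasDerivAt
    exact (HasDerivAt.scomp_of_eq 0 h1 h2 φ.map_zero.symm).deriv
  have h1 := (JetEq.succ_iff.1 h).2.apply_zero
  rw [key γ₁ φ rfl, key γ₂ ψ h0.symm] at h1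
  exact ProjD.ofVec_eq_of_chart (mem_chart_source E _) h0 (γ₁.horizontal 0 ht0)
    (γ₁.velocity_ne_zero 0 ht0) (γ₂.horizontal 0 ht0) (γ₂.velocity_ne_zero 0 ht0)
    φ.deriv_ne_zero ψ.deriv_ne_zero h1

/-- The unparameterized `k + 1`-jets of horizontal curves agree if and only if the unparameterized
`k`-jets of their prolongations do. -/
theorem unparamJet_succ_eq_iff (γ₁ γ₂ : HorizontalCurve D ε) (hε : 0 < ε) (k : ℕ) :
    (γ₁.toRegularCurve hε).unparamJet (k + 1) = (γ₂.toRegularCurve hε).unparamJet (k + 1) ↔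
      (γ₁.prolong.toRegularCurve hε).unparamJet k = (γ₂.prolong.toRegularCurve hε).unparamJet k := by
  set p₀ := γ₁.prolong.toFun 0 with hp₀
  have hpt : ∀ γ : HorizontalCurve D ε, (γ.prolong.toFun 0).pt = γ.toFun 0 := fun γ =>
    ProjD.ofVec_pt _ _
  rw [RegularCurve.unparamJet_eq_iff_jetEq (x := p₀.pt) (hpt γ₁).symm,
    RegularCurve.unparamJet_eq_iff_jetEq (γ := γ₁.prolong.toRegularCurve hε) (x := p₀) rfl]
  -- Once both prolongations pass through `p₀`, one chart of `ℙD`, with its adapted frame, describes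
  -- both near `0`, and the vector space statement applies.
  have hiff : γ₂.prolong.toFun 0 = p₀ → ((∃ φ ψ : Reparam,
        JetEq (k + 1) ((chartAt E p₀.pt ∘ γ₁.toFun) ∘ φ.toFun)
          ((chartAt E p₀.pt ∘ γ₂.toFun) ∘ ψ.toFun)) ↔
      ∃ φ ψ : Reparam, JetEq k ((chartAt (E × ℝ) p₀ ∘ γ₁.prolong.toFun) ∘ φ.toFun)
          ((chartAt (E × ℝ) p₀ ∘ γ₂.prolong.toFun) ∘ ψ.toFun)) := by
    intro h
    have hsrc := p₀.mem_chart_source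
    set F := p₀.adaptedFrame
    have hchart : ∀ γ : HorizontalCurve D ε, chartAt (E × ℝ) p₀ ∘ γ.prolong.toFun =
        fun t => ((chartAt E p₀.pt ∘ γ.toFun) t, (ProjD.slope F ∘ γ.prolong.toFun) t) := by
      intro γ
      funext t
      exact Prod.ext (congrArg (chartAt E p₀.pt) (ProjD.ofVec_pt _ _)) rfl
    have hslope : ∀ γ : HorizontalCurve D ε, γ.prolong.toFun 0 = p₀ →
        ContDiffAt ℝ ∞ (ProjD.slope F ∘ γ.prolong.toFun) 0 := fun γ hγ => by
      -- The slope is the second coordinate of the prolonged curve in the chart at `p₀`, so it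
      -- inherits its smoothness.
      have := (γ.prolong.toRegularCurve hε).contDiffAt_chart_comp (x := p₀) hγ
      exact contDiff_snd.contDiffAt.comp 0 this
    have hmem : ∀ γ : HorizontalCurve D ε, γ.prolong.toFun 0 = p₀ →
        γ.toFun 0 ∈ (chartAt E p₀.pt).source := fun γ hγ => by
      rw [← hpt γ, hγ]; exact hsrc.1
    rw [hchart γ₁, hchart γ₂]
    refine IsDirected.exists_jetEq_iff (x₀ := chartAt E p₀.pt p₀.pt)
      (contDiffAt_chartField hsrc.1 (F.smooth_X.contMDiffAt (F.isOpen.mem_nhds hsrc.2.1)))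
      (contDiffAt_chartField hsrc.1 (F.smooth_Y.contMDiffAt (F.isOpen.mem_nhds hsrc.2.1)))
      (linearIndependent_chartField F hsrc.1 hsrc.2.1)
      (γ₁.isDirected hε hsrc) (γ₂.isDirected hε (h ▸ hsrc))
      (γ₁.eventually_contDiffAt_chart hε (hmem γ₁ rfl)) (γ₂.eventually_contDiffAt_chart hε (hmem γ₂ h))
      (hslope γ₁ rfl) (hslope γ₂ h) (congrArg (chartAt E p₀.pt) (hpt γ₁).symm)
  constructor
  · rintro ⟨h0, h⟩
    -- `hiff` is available only after the prolonged points are known to coincide. In this direction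
    -- that comes from the first derivatives; in the other one it is part of the hypothesis.
    have h' : γ₂.prolong.toFun 0 = p₀ := by
      obtain ⟨φ, ψ, hφψ⟩ := h
      have e : p₀.pt = γ₁.toFun 0 := hpt γ₁
      rw [e] at hφψ h0
      exact (prolong_apply_zero_eq_of_jetEq hε h0.symm hφψ).symm
    exact ⟨h', (hiff h').1 h⟩
  · rintro ⟨h0, h⟩
    exact ⟨by rw [← h0]; exact (hpt γ₂).symm, (hiff h0).2 h⟩

end HorizontalCurve

/-! ### Iteration down to jets of order zero. -/

/-- The sum of jet order and number of prolongations is conserved. The order `j` must stay general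
in the induction on `i`: the case `(i + 1, j)` uses the case `(i, j + 1)` and then one exchange for
the curves prolonged `i` times. -/
theorem HorizontalCurve.unparamJet_iterProlong_eq_iff {E : Type} [NormedAddCommGroup E] [NormedSpace ℝ E]
    [FiniteDimensional ℝ E] {M : Type u} [TopologicalSpace M] [ChartedSpace E M]
    [IsManifold 𝓘(ℝ, E) ∞ M] {D : RankTwoDistribution E M} {ε : ℝ} (hε : 0 < ε)
    (γ₁ γ₂ : HorizontalCurve D ε) (i : ℕ) : ∀ j : ℕ,
    (γ₁.toRegularCurve hε).unparamJet (j + i) = (γ₂.toRegularCurve hε).unparamJet (j + i) ↔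
      ((γ₁.iterProlong i).toRegularCurve hε).unparamJet j =
        ((γ₂.iterProlong i).toRegularCurve hε).unparamJet j := by
  induction i with
  | zero => exact fun _ => Iff.rfl
  | succ i ih =>
    intro j
    rw [← add_assoc, add_right_comm]
    exact (ih (j + 1)).trans (unparamJet_succ_eq_iff _ _ hε j)

theorem RegularCurve.unparamJet_zero_eq_iff {E : Type v} [NormedAddCommGroup E] [NormedSpace ℝ E]
    {M : Type u} [TopologicalSpace M] [ChartedSpace E M] [IsManifold 𝓘(ℝ, E) ∞ M]
    {γ δ : RegularCurve E M} : γ.unparamJet 0 = δ.unparamJet 0 ↔ γ.toFun 0 = δ.toFun 0 := by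
  rw [RegularCurve.unparamJet_eq_iff_jetEq rfl]
  refine ⟨fun h => h.1.symm, fun h => ⟨h.symm, Reparam.id, Reparam.id, fun i hi => ?_⟩⟩
  obtain rfl : i = 0 := by lia
  simp [Reparam.id, h]

end CartanProlongation

theorem mainTheorem11 {n : ℕ} {M : Type*} [TopologicalSpace M]
    [ChartedSpace (EuclideanSpace ℝ (Fin n)) M]
    [IsManifold 𝓘(ℝ, EuclideanSpace ℝ (Fin n)) ∞ M]
    (D : RankTwoDistribution (EuclideanSpace ℝ (Fin n)) M)
    {ε : ℝ} (hε : 0 < ε) (γ₁ γ₂ : HorizontalCurve D ε) (k : ℕ) :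
    (γ₁.toRegularCurve hε).unparamJet k = (γ₂.toRegularCurve hε).unparamJet k ↔
      (γ₁.iterProlong k).toFun 0 = (γ₂.iterProlong k).toFun 0 := by
  -- All `k` orders are traded for prolongations, leaving jets of order `0`.
  have h := HorizontalCurve.unparamJet_iterProlong_eq_iff hε γ₁ γ₂ k 0
  rw [zero_add] at h
  exact h.trans RegularCurve.unparamJet_zero_eq_iff
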